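/- All logarithms are to base $2$, and entropies and divergences are in bits. **The sampler.** Let $P$ and $Q$ be probability measures on $\mathbb{R}$, $P$ continuous (atomless), $Q \ll P$ (so $Q$ is continuous as well), and let $r = dQ/dP$ be unimodal: for some mode $m \in [-\infty, \infty]$, $r$ is nondecreasing on $\{x \le m\}$ and nonincreasing on $\{x \ge m\}$. The sample-splitting process $Z = (Z_n)_{n \ge 1}$ is the random binary partition of $\mathbb{R}$, indexed by heap indices, with $Z_1 = \mathbb{R}$, $Z_{2n} = Z_n \cap (-\infty, X_n]$, $Z_{2n+1} = Z_n \cap (X_n, \infty)$, where, given $X_1, \dots, X_{n-1}$, $X_n$ has law $P|_{Z_n}/P(Z_n)$. Greedy rejection coding with sample splitting (GRCS) runs along a path in the tree: $I_0 = 1$, $S_d = Z_{I_d}$, $T_0 = 0$, and for $d = 0, 1, \dots$, with $t_d = dT_d/dP$, $$\alpha_{d+1} = \min\Big\{ r - t_d,\ \frac{1 - T_d(\mathbb{R})}{P(S_d)} \Big\}, \qquad A_{d+1}(S) = \int_S \alpha_{d+1}\, dP, \qquad \beta_{d+1} = \alpha_{d+1} \frac{P(S_d)}{1 - T_d(\mathbb{R})}.$$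 With $U_{I_d}$ uniform on $(0,1)$, it halts and returns $X_{I_d}$ if $U_{I_d} \le \beta_{d+1}(X_{I_d})$. Otherwise $I_{d+1} = 2 I_d + b_d$, where $b_d$ is a Bernoulli variable with success probability $$\frac{Q(Z_{2I_d+1}) - T_d(Z_{2I_d+1}) - A_{d+1}(Z_{2I_d+1})}{Q(S_d) - T_d(S_d) - A_{d+1}(S_d)},$$ and $T_{d+1}(S) = T_d(S \cap S_{d+1}) + A_{d+1}(S \cap S_{d+1}) + Q(S \setminus S_{d+1})$. The uniform variables and the coin tosses use independent randomness that is independent of $Z$. **Theorem.** There is an absolute constant $C$ such that the following holds. 1. For all $P$, $Q$ as above, GRCS halts almost surely, and if $D_{\mathrm{KL}}(Q \| P) < \infty$, its returned sample $X$ satisfies $$\mathbb{H}[X \mid Z] \le D_{\mathrm{KL}}(Q \| P) + 2 \log\big(D_{\mathrm{KL}}(Q \| P) + 1\big) + C.$$ 2. (Reverse channel coding.) Let $(X', Y)$ be a pair of random variables, $X'$ real-valued, such that the marginal law $P_{X'}$ is continuous and, for every $y$, $P_{X'|Y=y} \ll P_{X'}$ has a unimodal density ratio (jointly measurable in $x$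 and $y$). Draw $Y$ independently of the randomness of the sampler, including $Z$, and run GRCS with target $Q = P_{X'|Y}$ and proposal $P = P_{X'}$. Then it halts almost surely, and if $\mathbb{I}[X';Y] = \mathbb{E}_Y\big[D_{\mathrm{KL}}(P_{X'|Y} \| P_{X'})\big]$ is finite, its returned sample $X$ satisfies $$\mathbb{H}[X \mid Z] \le \mathbb{I}[X';Y] + 2 \log\big(\mathbb{I}[X';Y] + 1\big) + C.$$ -/

import Mathlib

open MeasureTheory ProbabilityTheory Set
open scoped ENNReal

/-! ## Shannon entropy and conditional entropy, in bits -/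

/-- Shannon entropy, in bits, of a probability measure on `ℝ`: the usual sum over the atoms if the
measure is discrete (carried by a countable set), and `∞` otherwise. -/
noncomputable def entropyBits (ν : Measure ℝ) : ℝ≥0∞ :=
  open scoped Classical in
  if ∃ s : Set ℝ, s.Countable ∧ ν sᶜ = 0 then
    ∑' y : ℝ, ENNReal.ofReal (Real.negMulLog (ν.real {y}) / Real.log 2)
  else ∞

/-- Conditional entropy `H[X | Z]`, in bits: the average over `z ∼ Z` of the entropy of the
conditional law of `X` given `Z = z`. -/
noncomputable def condEntropyBits {Ω E : Type*} [MeasurableSpace Ω] [MeasurableSpace E]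
    (X : Ω → ℝ) (Z : Ω → E) (μ : Measure Ω) [IsFiniteMeasure μ] : ℝ≥0∞ :=
  ∫⁻ z, entropyBits (condDistrib X Z μ z) ∂(μ.map Z)

/-! ## Unimodal functions -/

/-- `r` is unimodal: nondecreasing up to some mode `m` and nonincreasing from `m` on. The mode may
be `±∞` (so that monotone functions are unimodal), and `r` may take the value `∞`. -/
def IsUnimodal (r : ℝ → ℝ≥0∞) : Prop :=
  ∃ m : EReal, MonotoneOn r {x : ℝ | (x : EReal) ≤ m} ∧ AntitoneOn r {x : ℝ | m ≤ (x : EReal)}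

namespace GRC

/-! ## The sample-splitting partitioning process -/

/-- The cells `Z_n` of the binary partition of `ℝ` produced by the split points `x_1, x_2, …`, where
the nodes of the tree are numbered by heap indices: `Z_1 = ℝ`, and the two children of `Z_n` are
`Z_{2n} = Z_n ∩ (-∞, x_n]` and `Z_{2n+1} = Z_n ∩ (x_n, ∞)`. The index `0` is not used. -/
def cell (x : ℕ → ℝ) : ℕ → Set ℝ
  | 0 => univ
  | 1 => univ
  | n + 2 =>
    if Even n then cell x ((n + 2) / 2) ∩ Iic (x ((n + 2) / 2))
    else cell x ((n + 2) / 2) ∩ Ioi (x ((n + 2) / 2))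
  decreasing_by all_goals omega

theorem cell_one (x : ℕ → ℝ) : cell x 1 = univ := by simp [cell]

theorem cell_left (x : ℕ → ℝ) {n : ℕ} (hn : 1 ≤ n) :
    cell x (2 * n) = cell x n ∩ Iic (x n) := by
  obtain ⟨k, rfl⟩ : ∃ k, n = k + 1 := ⟨n - 1, by omega⟩
  rw [show 2 * (k + 1) = 2 * k + 2 by ring, cell, show (2 * k + 2) / 2 = k + 1 by omega]
  simp

theorem cell_right (x : ℕ → ℝ) {n : ℕ} (hn : 1 ≤ n) :
    cell x (2 * n + 1) = cell x n ∩ Ioi (x n) := by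
  obtain ⟨k, rfl⟩ : ∃ k, n = k + 1 := ⟨n - 1, by omega⟩
  rw [show 2 * (k + 1) + 1 = (2 * k + 1) + 2 by ring, cell,
    show (2 * k + 1 + 2) / 2 = k + 1 by omega]
  simp

/-- The partitioning process `Z = (Z_n)` as a random sequence of sets. -/
def cells {Ω : Type*} (X : ℕ → Ω → ℝ) (ω : Ω) : ℕ → Set ℝ :=
  cell (fun n => X n ω)

theorem measurableSet_cell (x : ℕ → ℝ) (n : ℕ) : MeasurableSet (cell x n) := by
  induction n using Nat.strong_induction_on with
  | _ n ih =>
    match n with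
    | 0 => simp [cell]
    | 1 => simp [cell]
    | n + 2 =>
      rw [cell]
      split_ifs
      · exact (ih _ (by omega)).inter measurableSet_Iic
      · exact (ih _ (by omega)).inter measurableSet_Ioi

theorem measurable_cells {Ω : Type*} [MeasurableSpace Ω] {X : ℕ → Ω → ℝ}
    (hX : ∀ n, Measurable (X n)) : Measurable (cells X) := by
  have key : ∀ (n : ℕ) (y : ℝ), MeasurableSet {ω | y ∈ cell (fun k => X k ω) n} := by
    intro n y
    induction n using Nat.strong_induction_on with
    | _ n ih =>
      match n with
      | 0 => simp [cell]
      | 1 => simp [cell]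
      | n + 2 =>
        simp only [cell]
        split_ifs
        · exact (ih _ (by omega)).inter (measurableSet_le measurable_const (hX _))
        · exact (ih _ (by omega)).inter (measurableSet_lt (hX _) measurable_const)
  refine measurable_pi_iff.2 fun n => measurable_set_iff.2 fun y => ?_
  exact measurableSet_setOfPred.1 (key n y)

/-- The sources of randomness of the sampler with proposal `P` and sample-splitting partition.

* `X n` is the sample drawn at the node `n ≥ 1`, which is also its split point: given the samples
  with smaller heap index, it has law `P|_{Z_n} / P(Z_n)`.
* `U n` and `V n` are i.i.d. uniform variables, independent of all the `X n`; `U n` decides about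
  acceptance at the node `n`, and `V n` is used to toss the biased coin that chooses a child of `n`.
-/
structure IsSampleSplittingSource {Ω : Type*} [MeasurableSpace Ω] (μ : Measure Ω)
    [IsFiniteMeasure μ] (P : Measure ℝ) (X U V : ℕ → Ω → ℝ) : Prop where
  measurable_X : ∀ n, Measurable (X n)
  measurable_U : ∀ n, Measurable (U n)
  measurable_V : ∀ n, Measurable (V n)
  condLaw_X : ∀ n, 1 ≤ n → ∀ᵐ ω ∂μ,
    condDistrib (X n) (fun ω (m : Fin n) => X m ω) μ (fun m : Fin n => X m ω)
      = P[|cells X ω n]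
  law_U : ∀ n, μ.map (U n) = volume.restrict (Icc 0 1)
  law_V : ∀ n, μ.map (V n) = volume.restrict (Icc 0 1)
  indep_UV : iIndepFun (fun i : ℕ ⊕ ℕ => Sum.elim U V i) μ
  indep_X : IndepFun (fun ω n => X n ω) (fun ω => ((fun n => U n ω), (fun n => V n ω))) μ

/-! ## Greedy rejection coding

A run is a deterministic function of the target `Q`, the proposal `P`, the density ratio
`r = dQ/dP`, the splits `x`, and the uniform variates `u` and `v`. -/

/-- The state after `d` rejections: the heap index `I_d`, the measure `T_d` of ruled-out mass, and
its density `t_d = dT_d/dP`. -/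
structure State where
  index : ℕ
  mass : Measure ℝ
  density : ℝ → ℝ≥0∞

variable (P Q : Measure ℝ) (r : ℝ → ℝ≥0∞) (x u v : ℕ → ℝ)

/-- The active cell `S_d = Z_{I_d}`. -/
def State.active (s : State) : Set ℝ := cell x s.index

/-- `α_{d+1}(y) = min {r(y) - t_d(y), (1 - T_d(ℝ)) / P(S_d)}`. -/
noncomputable def State.alpha (s : State) (y : ℝ) : ℝ≥0∞ :=
  min (r y - s.density y) ((1 - s.mass univ) / P (s.active x))

/-- `A_{d+1}(S) = ∫_S α_{d+1} dP`. -/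
noncomputable def State.accMass (s : State) : Measure ℝ := P.withDensity (s.alpha P r x)

/-- The acceptance probability `β_{d+1}(y) = α_{d+1}(y) P(S_d) / (1 - T_d(ℝ))`. -/
noncomputable def State.beta (s : State) (y : ℝ) : ℝ≥0∞ :=
  s.alpha P r x y * (P (s.active x) / (1 - s.mass univ))

/-- The probability of moving to the right child of the active cell: the fraction of the mass of
`Q` on the active cell, not accounted for so far, that lies in the right child. -/
noncomputable def State.rightProb (s : State) : ℝ≥0∞ :=
  let R := cell x (2 * s.index + 1)
  let S := s.active x
  (Q R - s.mass R - s.accMass P r x R) / (Q S - s.mass S - s.accMass P r x S)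

open scoped Classical in
/-- The next heap index `I_{d+1} = 2 I_d + b_d`, where the coin `b_d` with success probability
`rightProb` is tossed by means of the uniform variate `v` at the current node. -/
noncomputable def State.nextIndex (s : State) : ℕ :=
  2 * s.index + if ENNReal.ofReal (v s.index) ≤ s.rightProb P Q r x then 1 else 0

/-- One rejection:
`T_{d+1}(S) = T_d(S ∩ S_{d+1}) + A_{d+1}(S ∩ S_{d+1}) + Q(S ∩ S_{d+1}ᶜ)`, with the corresponding
density. -/
noncomputable def State.next (s : State) : State where
  index := s.nextIndex P Q r x v
  mass :=
    (s.mass + s.accMass P r x).restrict (cell x (s.nextIndex P Q r x v))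
      + Q.restrict (cell x (s.nextIndex P Q r x v))ᶜ
  density :=
    (cell x (s.nextIndex P Q r x v)).indicator (fun y => s.density y + s.alpha P r x y)
      + (cell x (s.nextIndex P Q r x v))ᶜ.indicator r

/-- The state after `d` rejections; `I_0 = 1` and `T_0 = 0`. -/
noncomputable def state : ℕ → State
  | 0 => ⟨1, 0, fun _ => 0⟩
  | d + 1 => (state d).next P Q r x v

/-- The sample at the `d`-th node of the search path is accepted: `U_{I_d} ≤ β_{d+1}(X_{I_d})`. -/
def Accepts (d : ℕ) : Prop :=
  ENNReal.ofReal (u (state P Q r x v d).index)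
    ≤ (state P Q r x v d).beta P r x (x (state P Q r x v d).index)

/-- The sampler halts. -/
def Terminates : Prop := ∃ d, Accepts P Q r x u v d

/-- `D* = min {d : U_{I_d} ≤ β_{d+1}(X_{I_d})}`. -/
noncomputable def stopTime : ℕ := sInf {d | Accepts P Q r x u v d}

/-- The returned sample `X_{I_{D*}}`. -/
noncomputable def returnedSample : ℝ := x (state P Q r x v (stopTime P Q r x u v)).index

/-- The function `t_d` in the state is indeed a density of the measure `T_d` with respect to `P`. -/
theorem state_mass_eq_withDensity (hr : Measurable r) (hQ : Q = P.withDensity r) (d : ℕ) :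
    Measurable (state P Q r x v d).density ∧
      (state P Q r x v d).mass = P.withDensity (state P Q r x v d).density := by
  induction d with
  | zero =>
    refine ⟨measurable_const, ?_⟩
    exact withDensity_zero.symm
  | succ d ih =>
    obtain ⟨hm, h⟩ := ih
    have ha : Measurable ((state P Q r x v d).alpha P r x) := (hr.sub hm).min measurable_const
    have hc := measurableSet_cell x ((state P Q r x v d).nextIndex P Q r x v)
    refine ⟨((hm.add ha).indicator hc).add (hr.indicator hc.compl), ?_⟩
    simp only [state, State.next]
    change _ = P.withDensity ((cell x _).indicator ((state P Q r x v d).density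
      + (state P Q r x v d).alpha P r x) + (cell x _)ᶜ.indicator r)
    rw [withDensity_add_left ((hm.add ha).indicator hc), withDensity_indicator hc,
      withDensity_indicator hc.compl, ← restrict_withDensity hc, ← restrict_withDensity hc.compl,
      ← hQ, h, State.accMass, ← withDensity_add_left hm]

end GRC

/-!
The argument rests on a description of the sampler by *levels*. If `h = L_d` is the level after `d`
rejections, the ruled-out mass `T_d` has density `min r h` on the active cell and `r` off it, so
that `1 - T_d(ℝ)` is the tail `w(h) = ∫ (r - h)⁺ dP`. One rejection raises the level from `h` to
`h + w(h) / P(S_d)`. As `r` is unimodal, the set where `r` exceeds the new level is an interval, and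
a rejected sample, which is also the split point, does not lie in it; hence one child holds all of
the remaining mass and the coin is deterministic (`GRC.state_invariant`). Which node is reached is
therefore a function of the split points and of the uniform variables `U` (`GRC.Reached`).

*Where the sampler halts.* At a node with remaining mass `w`, the rejection probability is `w' / w`,
with `w'` the remaining mass at the children. A potential on the nodes (`GRC.potential`) gives
`E[ln (1 / w)] ≤ 1` at the accepting node, by `ln t ≤ t - 1`, together with
`E[ln⁺ r(X)] ≤ ∫ r ln⁺ r dP ≤ D + 1`, where `D` is the relative entropy in nats
(`GRC.potential_step`). An accepted sample satisfies `r(X) ≥ h ≥ w / P(Z_m)`, where `m` is the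
parent of the accepting node, so `E[ln (1 / P(Z_m))] ≤ D + 2`
(`GRC.IsSampleSplittingSource.lintegral_parentCost_le`). The same potential shows that the sampler
halts: on an infinite path `w` tends to `0`, so the potential along the path tends to `∞`, although
its expectation is bounded (`GRC.IsSampleSplittingSource.ae_terminates`).

*How to name the node.* By the probability integral transform, a cell of probability `p` is split
into parts of probabilities `t` and `p - t` with `t` uniform on `[0, p]`. For the weight
`p / (1 - ln p) ^ 2`, the function `2 p / (1 - ln p) + p / (1 - ln p) ^ 2` solves the resulting
recursion for the expected total weight of the descendants of a cell, so the weights of all cells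
add up to `3` or less in expectation (`GRC.IsSampleSplittingSource.lintegral_tsum_weight_le`). Half
the weight of its parent, given to each node, is thus a code of expected total weight `4` or less,
with code lengths `ln 2 + ln (1 / p) + 2 ln (1 + ln (1 / p))`, where `p` is the probability of the
parent cell.

*Conclusion.* The split points are functions of the partition, so given `Z` the returned sample
is a point of a known countable set, indexed by the nodes. By Gibbs' inequality its conditional
entropy is at most the expected code length plus the expected total weight
(`GRC.condEntropyBits_le`), and concavity of the logarithm turns the bound on `E[ln (1 / P(Z_m))]`
into the bound on the entropy. A random target independent of the randomness of the sampler only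
averages the bounds for fixed targets, since the code does not depend on the target
(`GRC.IsSampleSplittingSource.random_target`); a fixed target is the special case of a constant `Y`.
-/

namespace GRC

/-! ### Logarithms and elementary inequalities -/

/-- The positive part `log⁺ a = max (ln a) 0` of the natural logarithm, with `log⁺ ∞ = ∞`. -/
noncomputable def logPlus (a : ℝ≥0∞) : ℝ≥0∞ := (ENNReal.log a).toENNReal

theorem measurable_logPlus : Measurable logPlus :=
  measurable_ereal_toENNReal.comp ENNReal.measurable_log

theorem logPlus_mono : Monotone logPlus := fun _ _ h =>
  EReal.toENNReal_le_toENNReal (ENNReal.log_monotone h)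

theorem logPlus_mul_le (a b : ℝ≥0∞) : logPlus (a * b) ≤ logPlus a + logPlus b := by
  rw [logPlus, ENNReal.log_mul_add]
  exact EReal.toENNReal_add_le

theorem logPlus_of_ne_top {a : ℝ≥0∞} (ha : a ≠ ∞) :
    logPlus a = ENNReal.ofReal (Real.log a.toReal) := by
  rcases eq_or_ne a 0 with rfl | h0
  · simp [logPlus]
  · rw [logPlus, ENNReal.log_pos_real h0 ha, EReal.toENNReal_of_ne_top (EReal.coe_ne_top _),
      EReal.toReal_coe]

theorem logPlus_top : logPlus ∞ = ∞ := by simp [logPlus]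

theorem logPlus_one : logPlus 1 = 0 := by simp [logPlus]

theorem logPlus_inv {a : ℝ≥0∞} (ha : a ≠ 0) :
    logPlus a⁻¹ = ENNReal.ofReal (-Real.log a.toReal) := by
  rw [logPlus_of_ne_top (ENNReal.inv_ne_top.2 ha), ENNReal.toReal_inv, Real.log_inv]

/-- The inequality behind `𝔼[ln (1 / w)] ≤ 1` for the surviving mass `w` at acceptance: if the mass
drops from `w` to `w'` with probability `w' / w` and the process stops otherwise, then
`ln (1 / w) + 1` pays for `ln (1 / w)` at the stop. It amounts to `ln t ≤ t - 1`. -/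
theorem logPlus_inv_potential {a w w' : ℝ≥0∞} (haw : a + w' = w) (hw : w ≠ 0) (hw1 : w ≤ 1) :
    a / w * logPlus w⁻¹ + w' / w * (logPlus w'⁻¹ + 1) ≤ logPlus w⁻¹ + 1 := by
  have hwt : w ≠ ∞ := ne_top_of_le_ne_top ENNReal.one_ne_top hw1
  have hat : a ≠ ∞ := ne_top_of_le_ne_top hwt (haw ▸ le_self_add)
  have hw't : w' ≠ ∞ := ne_top_of_le_ne_top hwt (haw ▸ le_add_self)
  rcases eq_or_ne w' 0 with rfl | hw'
  · have : a = w := by simpa using haw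
    rw [this, ENNReal.div_self hw hwt]
    simp
  · rw [logPlus_inv hw, logPlus_inv hw']
    lift a to NNReal using hat
    lift w to NNReal using hwt
    lift w' to NNReal using hw't
    have hw0 : (0 : ℝ) < w := by
      have : w ≠ 0 := by simpa using hw
      positivity
    have hw'0 : (0 : ℝ) < w' := by
      have : w' ≠ 0 := by simpa using hw'
      positivity
    have haw' : (a : ℝ) + w' = w := by exact_mod_cast haw
    have hw1' : (w : ℝ) ≤ 1 := by exact_mod_cast hw1
    have e1 : ((a : ℝ≥0∞) / w) = ENNReal.ofReal ((a : ℝ) / w) := by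
      rw [ENNReal.ofReal_div_of_pos hw0]; simp
    have e2 : ((w' : ℝ≥0∞) / w) = ENNReal.ofReal ((w' : ℝ) / w) := by
      rw [ENNReal.ofReal_div_of_pos hw0]; simp
    have l0 : Real.log w ≤ 0 := Real.log_nonpos hw0.le hw1'
    have hle : (w' : ℝ) ≤ w := by have := a.coe_nonneg; linarith
    have l1 : Real.log w' ≤ 0 := Real.log_nonpos hw'0.le (hle.trans hw1')
    simp only [ENNReal.coe_toReal]
    rw [e1, e2, ← ENNReal.ofReal_one, ← ENNReal.ofReal_add (by linarith) zero_le_one,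
      ← ENNReal.ofReal_add (by linarith) zero_le_one, ← ENNReal.ofReal_mul (by positivity),
      ← ENNReal.ofReal_mul (by positivity), ← ENNReal.ofReal_add]
    · apply ENNReal.ofReal_le_ofReal
      have key : Real.log (w / w') ≤ w / w' - 1 := Real.log_le_sub_one_of_pos (by positivity)
      rw [Real.log_div hw0.ne' hw'0.ne'] at key
      have key2 : (w' : ℝ) * (Real.log w - Real.log w') ≤ w - w' := by
        have := mul_le_mul_of_nonneg_left key hw'0.le
        rwa [mul_sub (w' : ℝ) (w / w') 1, mul_div_cancel₀ _ hw'0.ne', mul_one] at this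
      rw [div_mul_eq_mul_div, div_mul_eq_mul_div, ← add_div, div_le_iff₀ hw0, ← haw']
      rw [← haw'] at key2
      nlinarith
    · exact mul_nonneg (by positivity) (by linarith)
    · exact mul_nonneg (by positivity) (by linarith)

theorem logPlus_mul_self_le {a : ℝ≥0∞} (ha : a ≠ ∞) :
    logPlus a * a ≤ ENNReal.ofReal (InformationTheory.klFun a.toReal) + a := by
  lift a to NNReal using ha
  rw [logPlus_of_ne_top ENNReal.coe_ne_top, ENNReal.coe_toReal]
  have h0 := InformationTheory.klFun_nonneg a.coe_nonneg
  rcases le_total (a : ℝ) 1 with h | h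
  · rw [ENNReal.ofReal_of_nonpos (Real.log_nonpos a.coe_nonneg h)]
    simp
  · rw [← ENNReal.ofReal_coe_nnreal, ← ENNReal.ofReal_mul (Real.log_nonneg h),
      ← ENNReal.ofReal_add h0 a.coe_nonneg]
    apply ENNReal.ofReal_le_ofReal
    rw [InformationTheory.klFun]
    linarith

/-- Gibbs' inequality for a single atom and an unnormalized code weight `exp (-c)`. -/
theorem negMulLog_le_mul_add_exp {p : ℝ} (hp : 0 ≤ p) (c : ℝ) :
    Real.negMulLog p ≤ p * c + Real.exp (-c) := by
  rcases hp.eq_or_lt with rfl | hp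
  · simp [Real.exp_nonneg]
  · have h := Real.add_one_le_exp (-c - Real.log p)
    rw [Real.exp_sub, Real.exp_log hp] at h
    have h2 := mul_le_mul_of_nonneg_left h hp.le
    rw [mul_div_cancel₀ _ hp.ne'] at h2
    rw [Real.negMulLog]
    nlinarith

/-! ### The code weights -/

/-- The weight that the code for tree nodes gives to each pair of children of a cell of
probability `p`. -/
noncomputable def weight (p : ℝ) : ℝ := p / (1 - Real.log p) ^ 2

/-- The expected total weight of all descendants of a cell of probability `p` when cells are
split uniformly at random: the solution of `G p = weight p + (2 / p) ∫₀ᵖ G`. -/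
noncomputable def totalWeight (p : ℝ) : ℝ :=
  2 * p / (1 - Real.log p) + p / (1 - Real.log p) ^ 2

theorem measurable_weight : Measurable weight := by unfold weight; fun_prop

theorem measurable_totalWeight : Measurable totalWeight := by unfold totalWeight; fun_prop

theorem one_le_one_sub_log {p : ℝ} (hp0 : 0 ≤ p) (hp1 : p ≤ 1) : 1 ≤ 1 - Real.log p := by
  have := Real.log_nonpos hp0 hp1
  linarith

theorem totalWeight_nonneg {p : ℝ} (hp0 : 0 ≤ p) (hp1 : p ≤ 1) : 0 ≤ totalWeight p := by
  have := one_le_one_sub_log hp0 hp1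
  unfold totalWeight
  positivity

theorem hasDerivAt_sq_div_one_sub_log {p : ℝ} (hp0 : 0 < p) (hp1 : p ≤ 1) :
    HasDerivAt (fun t : ℝ => t ^ 2 / (1 - Real.log t)) (totalWeight p) p := by
  have h1 := one_le_one_sub_log hp0.le hp1
  have h := (hasDerivAt_pow 2 p).div ((Real.hasDerivAt_log hp0.ne').const_sub 1) (by positivity)
  refine h.congr_deriv ?_
  unfold totalWeight
  have h0 : 1 - Real.log p ≠ 0 := by positivity
  field_simp
  simp
  ring

theorem continuousOn_sq_div_one_sub_log :
    ContinuousOn (fun t : ℝ => t ^ 2 / (1 - Real.log t)) (Icc 0 1) := by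
  intro p hp
  rcases hp.1.eq_or_lt with rfl | h0
  · -- near `0` the function lies between `0` and `t ^ 2`
    have : Filter.Tendsto (fun t : ℝ => t ^ 2) (nhdsWithin 0 (Icc 0 1)) (nhds 0) := by
      have h : ContinuousWithinAt (fun t : ℝ => t ^ 2) (Icc 0 1) 0 := by fun_prop
      simpa [ContinuousWithinAt] using h
    rw [ContinuousWithinAt]
    simp only [ne_eq, OfNat.ofNat_ne_zero, not_false_eq_true, zero_pow, zero_div]
    refine tendsto_of_tendsto_of_tendsto_of_le_of_le' tendsto_const_nhds this ?_ ?_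
    · filter_upwards [self_mem_nhdsWithin] with t ht
      have := one_le_one_sub_log ht.1 ht.2
      positivity
    · filter_upwards [self_mem_nhdsWithin] with t ht
      exact div_le_self (by positivity) (one_le_one_sub_log ht.1 ht.2)
  · exact (hasDerivAt_sq_div_one_sub_log h0 hp.2).continuousAt.continuousWithinAt

theorem lintegral_totalWeight {p : ℝ} (hp0 : 0 ≤ p) (hp1 : p ≤ 1) :
    ∫⁻ t in Icc 0 p, ENNReal.ofReal (totalWeight t)
      = ENNReal.ofReal (p ^ 2 / (1 - Real.log p)) := by
  have hc : ContinuousOn (fun t : ℝ => t ^ 2 / (1 - Real.log t)) (Icc 0 p) :=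
    continuousOn_sq_div_one_sub_log.mono (Icc_subset_Icc_right hp1)
  have hd : ∀ t ∈ Ioo 0 p, HasDerivAt (fun t : ℝ => t ^ 2 / (1 - Real.log t)) (totalWeight t) t :=
    fun t ht => hasDerivAt_sq_div_one_sub_log ht.1 (ht.2.le.trans hp1)
  have hn : ∀ t ∈ Ioo 0 p, 0 ≤ totalWeight t :=
    fun t ht => totalWeight_nonneg ht.1.le (ht.2.le.trans hp1)
  have hi := intervalIntegral.integrableOn_deriv_of_nonneg hc hd hn
  have hI := intervalIntegral.integral_eq_sub_of_hasDerivAt_of_le hp0 hc hd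
    ((intervalIntegrable_iff_integrableOn_Ioc_of_le hp0).2 hi)
  rw [intervalIntegral.integral_of_le hp0, integral_Ioc_eq_integral_Ioo] at hI
  rw [Measure.restrict_congr_set Ioo_ae_eq_Icc.symm,
    ← ofReal_integral_eq_lintegral_ofReal (hi.mono_set Ioo_subset_Ioc_self), hI]
  · simp
  · filter_upwards [ae_restrict_mem measurableSet_Ioo] with t ht using hn t ht

theorem weight_add_eq_totalWeight {p : ℝ} (hp0 : 0 < p) :
    weight p + 2 * (p⁻¹ * (p ^ 2 / (1 - Real.log p))) = totalWeight p := by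
  unfold weight totalWeight
  field_simp
  ring

/-! ### The search path of the sampler for a unimodal density ratio -/

/-- The mass `∫ (r - h)⁺ dP` of the target above the level `h`. -/
noncomputable def tail (P : Measure ℝ) (r : ℝ → ℝ≥0∞) (h : ℝ≥0∞) : ℝ≥0∞ := ∫⁻ y, (r y - h) ∂P

/-- The level `L` up to which the density ratio is ruled out when the search arrives at a node:
`L = 0` at the root, and `L + tail L / P (Z_n)` at the children of a node `n` with level `L`. -/
noncomputable def level (P : Measure ℝ) (r : ℝ → ℝ≥0∞) (x : ℕ → ℝ) : ℕ → ℝ≥0∞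
  | 0 => 0
  | 1 => 0
  | n + 2 => level P r x ((n + 2) / 2)
      + tail P r (level P r x ((n + 2) / 2)) / P (cell x ((n + 2) / 2))
  decreasing_by all_goals omega

/-- The level at the children of the node `n`. -/
noncomputable def nextLevel (P : Measure ℝ) (r : ℝ → ℝ≥0∞) (x : ℕ → ℝ) (n : ℕ) : ℝ≥0∞ :=
  level P r x n + tail P r (level P r x n) / P (cell x n)

/-- The acceptance density at the node `n` with respect to `P`, on the cell of `n`. -/
noncomputable def nodeAlpha (P : Measure ℝ) (r : ℝ → ℝ≥0∞) (x : ℕ → ℝ) (n : ℕ) (y : ℝ) : ℝ≥0∞ :=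
  min (r y - level P r x n) (tail P r (level P r x n) / P (cell x n))

/-- The probability of accepting the sample `y` at the node `n`. -/
noncomputable def nodeBeta (P : Measure ℝ) (r : ℝ → ℝ≥0∞) (x : ℕ → ℝ) (n : ℕ) (y : ℝ) : ℝ≥0∞ :=
  nodeAlpha P r x n y * (P (cell x n) / tail P r (level P r x n))

/-- The search path passes through the node `n`. After a rejection at the parent `m`, the right
child is chosen iff mass is left there; the last condition says that all of the remaining mass
lies in the cell of `n`. In contrast to `GRC.state`, no coin tosses are involved. -/
def Reached (P : Measure ℝ) (r : ℝ → ℝ≥0∞) (x u : ℕ → ℝ) : ℕ → Prop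
  | 0 => False
  | 1 => True
  | n + 2 => Reached P r x u ((n + 2) / 2)
      ∧ nodeBeta P r x ((n + 2) / 2) (x ((n + 2) / 2)) < ENNReal.ofReal (u ((n + 2) / 2))
      ∧ (Even n ↔ ∫⁻ y in cell x (2 * ((n + 2) / 2) + 1),
          (r y - nextLevel P r x ((n + 2) / 2)) ∂P = 0)
      ∧ ∫⁻ y in cell x (n + 2), (r y - nextLevel P r x ((n + 2) / 2)) ∂P
          = tail P r (nextLevel P r x ((n + 2) / 2))
  decreasing_by all_goals omega

variable {P Q : Measure ℝ} {r : ℝ → ℝ≥0∞} {x u v : ℕ → ℝ}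

theorem tail_antitone : Antitone (tail P r) := fun _ _ h =>
  lintegral_mono fun _ => tsub_le_tsub_left h _

theorem tail_le (h : ℝ≥0∞) : tail P r h ≤ ∫⁻ y, r y ∂P := lintegral_mono fun _ => tsub_le_self

theorem tail_zero : tail P r 0 = ∫⁻ y, r y ∂P := by simp [tail]

theorem level_one : level P r x 1 = 0 := by simp [level]

theorem level_of_two_le {m : ℕ} (hm : 2 ≤ m) : level P r x m = nextLevel P r x (m / 2) := by
  obtain ⟨k, rfl⟩ : ∃ k, m = k + 2 := ⟨m - 2, by omega⟩
  rw [level, nextLevel]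

theorem level_left {n : ℕ} (hn : 1 ≤ n) : level P r x (2 * n) = nextLevel P r x n := by
  rw [level_of_two_le (by omega), show 2 * n / 2 = n by omega]

theorem level_right {n : ℕ} (hn : 1 ≤ n) : level P r x (2 * n + 1) = nextLevel P r x n := by
  rw [level_of_two_le (by omega), show (2 * n + 1) / 2 = n by omega]

theorem reached_one : Reached P r x u 1 := by simp [Reached]

theorem not_reached_zero : ¬ Reached P r x u 0 := by simp [Reached]

theorem reached_of_two_le {m : ℕ} (hm : 2 ≤ m) : Reached P r x u m ↔
    Reached P r x u (m / 2) ∧ nodeBeta P r x (m / 2) (x (m / 2)) < ENNReal.ofReal (u (m / 2))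
      ∧ (Even m ↔ ∫⁻ y in cell x (2 * (m / 2) + 1), (r y - nextLevel P r x (m / 2)) ∂P = 0)
      ∧ ∫⁻ y in cell x m, (r y - nextLevel P r x (m / 2)) ∂P
          = tail P r (nextLevel P r x (m / 2)) := by
  obtain ⟨k, rfl⟩ : ∃ k, m = k + 2 := ⟨m - 2, by omega⟩
  rw [Reached, show Even (k + 2) ↔ Even k by simp [Nat.even_add]]

theorem Reached.setLIntegral_eq {n : ℕ} (h : Reached P r x u n) :
    ∫⁻ y in cell x n, (r y - level P r x n) ∂P = tail P r (level P r x n) := by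
  match n with
  | 0 => exact absurd h not_reached_zero
  | 1 => simp [cell_one, tail]
  | n + 2 =>
    rw [level_of_two_le (by omega)]
    exact ((reached_of_two_le (by omega)).1 h).2.2.2

/-- At most one child of a node is on the search path. -/
theorem not_reached_left_and_right {n : ℕ} (hn : 1 ≤ n) (h1 : Reached P r x u (2 * n))
    (h2 : Reached P r x u (2 * n + 1)) : False := by
  have h1' := ((reached_of_two_le (by omega)).1 h1).2.2.1
  have h2' := ((reached_of_two_le (by omega)).1 h2).2.2.1
  rw [show 2 * n / 2 = n by omega] at h1'
  rw [show (2 * n + 1) / 2 = n by omega] at h2'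
  exact absurd (h2'.2 (h1'.1 (by simp))) (by simp)

theorem min_add_min_tsub (a h e : ℝ≥0∞) : min a h + min (a - h) e = min a (h + e) := by
  rcases le_total a h with hl | hl
  · rw [min_eq_left hl, tsub_eq_zero_of_le hl, min_eq_left (zero_le (a := e)), add_zero,
      min_eq_left (hl.trans le_self_add)]
  · rw [min_eq_right hl, ← min_add_add_left, add_tsub_cancel_of_le hl]

theorem min_tsub_add_tsub (a h e : ℝ≥0∞) : min (a - h) e + (a - (h + e)) = a - h := by
  rw [← tsub_tsub, add_comm, tsub_add_min]

theorem le_nextLevel (n : ℕ) : level P r x n ≤ nextLevel P r x n := le_self_add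

theorem cell_left_union_right {n : ℕ} (hn : 1 ≤ n) :
    cell x (2 * n) ∪ cell x (2 * n + 1) = cell x n := by
  rw [cell_left x hn, cell_right x hn, ← inter_union_distrib_left, Iic_union_Ioi, inter_univ]

theorem disjoint_cell_left_right {n : ℕ} (hn : 1 ≤ n) :
    Disjoint (cell x (2 * n)) (cell x (2 * n + 1)) := by
  rw [cell_left x hn, cell_right x hn]
  exact ((Iic_disjoint_Ioi le_rfl).mono inter_subset_right inter_subset_right)

theorem setLIntegral_cell_add {n : ℕ} (hn : 1 ≤ n) (f : ℝ → ℝ≥0∞) :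
    ∫⁻ y in cell x (2 * n), f y ∂P + ∫⁻ y in cell x (2 * n + 1), f y ∂P
      = ∫⁻ y in cell x n, f y ∂P := by
  rw [← lintegral_union (measurableSet_cell _ _) (disjoint_cell_left_right hn),
    cell_left_union_right hn]

/-- If all of the mass above the level `h` lies in `S`, then the same is true of higher levels. -/
theorem setLIntegral_tsub_eq_tail {S : Set ℝ} (hS : MeasurableSet S) {h h' : ℝ≥0∞} (hh : h ≤ h')
    (hfin : tail P r h ≠ ∞) (he : ∫⁻ y in S, (r y - h) ∂P = tail P r h) :
    ∫⁻ y in S, (r y - h') ∂P = tail P r h' := by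
  have h1 := lintegral_add_compl (fun y => r y - h) hS (μ := P)
  have h2 := lintegral_add_compl (fun y => r y - h') hS (μ := P)
  change _ = tail P r h at h1
  change _ = tail P r h' at h2
  rw [he] at h1
  have h3 : ∫⁻ y in Sᶜ, (r y - h) ∂P = 0 := by
    have : tail P r h + ∫⁻ y in Sᶜ, (r y - h) ∂P = tail P r h + 0 := by rw [h1, add_zero]
    exact (ENNReal.add_right_inj hfin).1 this
  have h4 : ∫⁻ y in Sᶜ, (r y - h') ∂P = 0 :=
    le_antisymm ((lintegral_mono fun _ => tsub_le_tsub_left hh _).trans h3.le) zero_le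
  rw [← h2, h4, add_zero]

theorem _root_.IsUnimodal.lt_of_lt_of_lt (hu : IsUnimodal r) {h : ℝ≥0∞} {a b c : ℝ} (hab : a ≤ b)
    (hbc : b ≤ c) (ha : h < r a) (hc : h < r c) : h < r b := by
  obtain ⟨m, h1, h2⟩ := hu
  rcases le_total (b : EReal) m with hb | hb
  · exact ha.trans_le (h1 (by simpa using (EReal.coe_le_coe_iff.2 hab).trans hb) hb hab)
  · exact hc.trans_le (h2 hb (by simpa using hb.trans (EReal.coe_le_coe_iff.2 hbc)) hbc)

/-- Conditions on a realization of the sources of randomness that hold almost surely. -/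
structure Regular (P : Measure ℝ) (x u v : ℕ → ℝ) : Prop where
  mem_cell : ∀ n, 1 ≤ n → x n ∈ cell x n
  measure_cell_ne_zero : ∀ n, 1 ≤ n → P (cell x n) ≠ 0
  u_pos : ∀ n, 0 < u n
  u_le_one : ∀ n, u n ≤ 1
  v_pos : ∀ n, 0 < v n
  v_le_one : ∀ n, v n ≤ 1

/-- Only samples at which `r` is below the new level can be rejected. -/
theorem le_nextLevel_of_nodeBeta_lt_one [IsFiniteMeasure P] {n : ℕ} (hP : P (cell x n) ≠ 0)
    (hw : tail P r (level P r x n) ≠ 0) (hwt : tail P r (level P r x n) ≠ ∞) {y : ℝ}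
    (h : nodeBeta P r x n y < 1) : r y ≤ nextLevel P r x n := by
  by_contra! hlt
  refine absurd h (not_lt.2 (le_of_eq ?_))
  rw [nodeBeta, nodeAlpha, min_eq_right, div_eq_mul_inv, div_eq_mul_inv]
  · rw [mul_assoc, ← mul_assoc _ _ (tail P r (level P r x n))⁻¹,
      ENNReal.inv_mul_cancel hP (measure_ne_top _ _), one_mul, ENNReal.mul_inv_cancel hw hwt]
  · refine ENNReal.le_sub_of_add_le_left ?_ hlt.le
    exact ne_top_of_lt ((le_nextLevel n).trans_lt hlt)

/-- After a rejection at a node that the search path passes through, all of the remaining mass lies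
in one of the two children: the sample is not in the interval `{r > L}`, with `L` the new level. -/
theorem Reached.setLIntegral_right [IsFiniteMeasure P] (hu : IsUnimodal r)
    (hfin : ∫⁻ y, r y ∂P ≠ ∞) (hreg : Regular P x u v) {n : ℕ} (hn : 1 ≤ n)
    (h : Reached P r x u n) (hrej : nodeBeta P r x n (x n) < ENNReal.ofReal (u n))
    (hR : ∫⁻ y in cell x (2 * n + 1), (r y - nextLevel P r x n) ∂P ≠ 0) :
    ∫⁻ y in cell x (2 * n + 1), (r y - nextLevel P r x n) ∂P
      = tail P r (nextLevel P r x n) := by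
  have hft : ∀ h, tail P r h ≠ ∞ := fun h => ne_top_of_le_ne_top hfin (tail_le h)
  have hS := setLIntegral_tsub_eq_tail (measurableSet_cell x n) (le_nextLevel n) (hft _)
    h.setLIntegral_eq
  have hw : tail P r (level P r x n) ≠ 0 := by
    intro h0
    refine hR (le_antisymm ?_ zero_le)
    rw [← h0]
    exact (setLIntegral_le_lintegral _ _).trans
      (lintegral_mono fun _ => tsub_le_tsub_left (le_nextLevel n) _)
  have hx : r (x n) ≤ nextLevel P r x n := by
    refine le_nextLevel_of_nodeBeta_lt_one (hreg.measure_cell_ne_zero n hn) hw (hft _)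
      (hrej.trans_le ?_)
    rw [← ENNReal.ofReal_one]
    exact ENNReal.ofReal_le_ofReal (hreg.u_le_one n)
  obtain ⟨y, hy, hry⟩ : ∃ y ∈ cell x (2 * n + 1), nextLevel P r x n < r y := by
    by_contra! hc
    refine hR ?_
    rw [setLIntegral_congr_fun (g := fun _ => 0) (measurableSet_cell _ _)
      fun y hy => tsub_eq_zero_of_le (hc y hy)]
    simp
  rw [cell_right x hn] at hy
  rw [← hS, ← setLIntegral_cell_add hn]
  rw [setLIntegral_congr_fun (s := cell x (2 * n)) (g := fun _ => 0) (measurableSet_cell _ _),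
    lintegral_zero, zero_add]
  intro z hz
  rw [cell_left x hn] at hz
  refine tsub_eq_zero_of_le (not_lt.1 fun hlt => absurd hx (not_le.2 ?_))
  exact hu.lt_of_lt_of_lt hz.2 (le_of_lt hy.2) hlt hry

section State

variable (hr : Measurable r) (hQ : Q = P.withDensity r)
  (hr1 : ∫⁻ y, r y ∂P = 1)

open scoped Classical in
include hr hQ hr1 in
/-- If the density of ruled-out mass is `min r L` on the active cell and `r` elsewhere, and if all
of the mass above `L` lies in the active cell, then the remaining mass is `tail L`. -/
theorem one_sub_mass (d : ℕ)
    (hd : ∀ y, (state P Q r x v d).density y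
      = (if y ∈ cell x (state P Q r x v d).index then
          min (r y) (level P r x (state P Q r x v d).index) else r y))
    (he : ∫⁻ y in cell x (state P Q r x v d).index,
        (r y - level P r x (state P Q r x v d).index) ∂P
      = tail P r (level P r x (state P Q r x v d).index)) :
    1 - (state P Q r x v d).mass univ = tail P r (level P r x (state P Q r x v d).index) := by
  obtain ⟨hm, hmass⟩ := state_mass_eq_withDensity P Q r x v hr hQ d
  have hle : ∀ y, (state P Q r x v d).density y ≤ r y := by
    intro y; rw [hd]; split_ifs <;> simp
  rw [hmass, withDensity_apply _ MeasurableSet.univ, Measure.restrict_univ, ← hr1,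
    ← lintegral_sub hm
      (ne_top_of_le_ne_top (hr1 ▸ ENNReal.one_ne_top) (lintegral_mono hle))
      (.of_forall hle), ← he, ← lintegral_indicator (measurableSet_cell _ _)]
  refine lintegral_congr fun y => ?_
  by_cases hy : y ∈ cell x (state P Q r x v d).index
  · rw [indicator_of_mem hy, hd, if_pos hy, tsub_min]
  · rw [indicator_of_notMem hy, hd, if_neg hy, tsub_self]

open scoped Classical in
include hr hQ hr1 in
/-- The loop invariant of the sampler: after `d` rejections the search path has arrived at a node
`n` at depth `d`, and the density of the ruled-out mass is `min r (level n)` on the cell of `n`,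
and `r` elsewhere. -/
theorem state_invariant [IsFiniteMeasure P] (hu : IsUnimodal r) (hreg : Regular P x u v) (d : ℕ)
    (hrej : ∀ k < d, ¬ Accepts P Q r x u v k) :
    2 ^ d ≤ (state P Q r x v d).index ∧ (state P Q r x v d).index < 2 ^ (d + 1) ∧
      Reached P r x u (state P Q r x v d).index ∧
      (∀ y, (state P Q r x v d).density y
        = (if y ∈ cell x (state P Q r x v d).index then
            min (r y) (level P r x (state P Q r x v d).index) else r y)) ∧
      (∀ y ∈ cell x (state P Q r x v d).index, (state P Q r x v d).beta P r x y
        = nodeBeta P r x (state P Q r x v d).index y) := by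
  -- the formula for the acceptance probability follows from the other claims
  have hbeta : ∀ d, Reached P r x u (state P Q r x v d).index →
      (∀ y, (state P Q r x v d).density y
        = (if y ∈ cell x (state P Q r x v d).index then
            min (r y) (level P r x (state P Q r x v d).index) else r y)) →
      (∀ y ∈ cell x (state P Q r x v d).index,
        (state P Q r x v d).alpha P r x y = nodeAlpha P r x (state P Q r x v d).index y) ∧
      (∀ y ∈ cell x (state P Q r x v d).index, (state P Q r x v d).beta P r x y
        = nodeBeta P r x (state P Q r x v d).index y) := by
    intro d h1 h2
    have hm := one_sub_mass hr hQ hr1 d h2 h1.setLIntegral_eq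
    have ha : ∀ y ∈ cell x (state P Q r x v d).index,
        (state P Q r x v d).alpha P r x y = nodeAlpha P r x (state P Q r x v d).index y := by
      intro y hy
      rw [State.alpha, nodeAlpha, State.active, hm, h2, if_pos hy, tsub_min]
    refine ⟨ha, fun y hy => ?_⟩
    rw [State.beta, nodeBeta, ha y hy, hm, State.active]
  induction d with
  | zero =>
    have h1 : Reached P r x u (state P Q r x v 0).index := by
      simpa [state] using reached_one
    have h2 : ∀ y, (state P Q r x v 0).density y
        = (if y ∈ cell x (state P Q r x v 0).index then
            min (r y) (level P r x (state P Q r x v 0).index) else r y) := by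
      simp [state, cell_one, level_one]
    exact ⟨by simp [state], by simp [state], h1, h2, (hbeta 0 h1 h2).2⟩
  | succ d ih =>
    obtain ⟨h2d, h2d', hreach, hdens, hbet⟩ := ih fun k hk => hrej k (by omega)
    have halpha := (hbeta d hreach hdens).1
    have hacc := hrej d (by omega)
    obtain ⟨hmeas, hmass⟩ := state_mass_eq_withDensity P Q r x v hr hQ d
    have hnext : state P Q r x v (d + 1) = (state P Q r x v d).next P Q r x v := rfl
    set s := state P Q r x v d with hs
    set n := s.index with hn
    have hn1 : 1 ≤ n := Nat.one_le_two_pow.trans h2d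
    have hrejn : nodeBeta P r x n (x n) < ENNReal.ofReal (u n) := by
      rw [Accepts, not_le, ← hs, ← hn, hbet _ (hreg.mem_cell n hn1)] at hacc
      exact hacc
    have hrfin : ∫⁻ y, r y ∂P ≠ ∞ := hr1 ▸ ENNReal.one_ne_top
    have hft : ∀ h, tail P r h ≠ ∞ := fun h => ne_top_of_le_ne_top hrfin (tail_le h)
    have hsum : ∀ y ∈ cell x n,
        s.density y + s.alpha P r x y = min (r y) (nextLevel P r x n) := by
      intro y hy
      rw [halpha y hy, hdens, if_pos hy, nodeAlpha, min_add_min_tsub, nextLevel]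
    -- the mass that remains on a part of the active cell
    have hrem : ∀ R ⊆ cell x n, MeasurableSet R →
        Q R - s.mass R - s.accMass P r x R = ∫⁻ y in R, (r y - nextLevel P r x n) ∂P := by
      intro R hR hRm
      have hc : ∀ y ∈ R, s.density y + s.alpha P r x y = min (r y) (nextLevel P r x n) :=
        fun y hy => hsum y (hR hy)
      rw [State.accMass, hmass, hQ, withDensity_apply _ hRm, withDensity_apply _ hRm,
        withDensity_apply _ hRm, tsub_tsub, ← lintegral_add_left hmeas,
        setLIntegral_congr_fun hRm hc, ← lintegral_sub (hr.min measurable_const)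
          (ne_top_of_le_ne_top hrfin ((lintegral_mono fun _ => min_le_left _ _).trans
            (setLIntegral_le_lintegral _ _)))
          (.of_forall fun _ => min_le_left _ _)]
      exact lintegral_congr fun y => tsub_min
    have hS := setLIntegral_tsub_eq_tail (measurableSet_cell x n) (le_nextLevel n) (hft _)
      hreach.setLIntegral_eq
    have hprob : s.rightProb P Q r x
        = (∫⁻ y in cell x (2 * n + 1), (r y - nextLevel P r x n) ∂P)
          / tail P r (nextLevel P r x n) := by
      rw [State.rightProb, ← hn, State.active, ← hn, hrem _ subset_rfl (measurableSet_cell _ _), hS,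
        hrem _ _ (measurableSet_cell _ _)]
      rw [cell_right x hn1]
      exact inter_subset_left
    -- the coin toss is deterministic: all of the remaining mass is in one child
    have hidx : (s.nextIndex P Q r x v = 2 * n ∨ s.nextIndex P Q r x v = 2 * n + 1) ∧
        Reached P r x u (s.nextIndex P Q r x v) := by
      by_cases hR : ∫⁻ y in cell x (2 * n + 1), (r y - nextLevel P r x n) ∂P = 0
      · have : s.nextIndex P Q r x v = 2 * n := by
          rw [State.nextIndex, hprob, hR, ENNReal.zero_div, if_neg, add_zero]
          rw [nonpos_iff_eq_zero, ENNReal.ofReal_eq_zero, not_le]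
          exact hreg.v_pos _
        refine ⟨.inl this, ?_⟩
        rw [this, reached_of_two_le (by omega), show 2 * n / 2 = n by omega]
        refine ⟨hreach, hrejn, by simp [hR], ?_⟩
        rw [← hS, ← setLIntegral_cell_add hn1, hR, add_zero]
      · have hR' := hreach.setLIntegral_right hu hrfin hreg hn1 hrejn hR
        have : s.nextIndex P Q r x v = 2 * n + 1 := by
          rw [State.nextIndex, hprob, hR', ENNReal.div_self (hR' ▸ hR) (hft _), if_pos]
          rw [← ENNReal.ofReal_one]
          exact ENNReal.ofReal_le_ofReal (hreg.v_le_one _)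
        refine ⟨.inr this, ?_⟩
        rw [this, reached_of_two_le (by omega), show (2 * n + 1) / 2 = n by omega]
        exact ⟨hreach, hrejn, by simp [hR], hR'⟩
    have hnidx : (state P Q r x v (d + 1)).index = s.nextIndex P Q r x v := by rw [hnext]; rfl
    have hreach' : Reached P r x u (state P Q r x v (d + 1)).index := hnidx ▸ hidx.2
    have hlev : level P r x (s.nextIndex P Q r x v) = nextLevel P r x n := by
      rcases hidx.1 with h | h
      · rw [h, level_left hn1]
      · rw [h, level_right hn1]
    have hsub : cell x (s.nextIndex P Q r x v) ⊆ cell x n := by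
      rw [← cell_left_union_right hn1]
      rcases hidx.1 with h | h
      · rw [h]; exact subset_union_left
      · rw [h]; exact subset_union_right
    have hdens' : ∀ y, (state P Q r x v (d + 1)).density y
        = (if y ∈ cell x (state P Q r x v (d + 1)).index then
            min (r y) (level P r x (state P Q r x v (d + 1)).index) else r y) := by
      intro y
      rw [hnidx, hlev, hnext]
      simp only [State.next, Pi.add_apply]
      by_cases hy : y ∈ cell x (s.nextIndex P Q r x v)
      · rw [indicator_of_mem hy, if_pos hy, indicator_of_notMem (by simpa using hy), add_zero,
          hsum y (hsub hy)]
      · rw [indicator_of_notMem hy, if_neg hy, indicator_of_mem (by simpa using hy), zero_add]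
    refine ⟨?_, ?_, hreach', hdens', (hbeta (d + 1) hreach' hdens').2⟩
    · rw [hnidx, pow_succ]; rcases hidx.1 with h | h <;> omega
    · rw [hnidx, pow_succ]; rcases hidx.1 with h | h <;> omega

include hr hQ hr1 in
theorem accepts_iff [IsFiniteMeasure P] (hu : IsUnimodal r) (hreg : Regular P x u v) (d : ℕ)
    (hrej : ∀ k < d, ¬ Accepts P Q r x u v k) :
    Accepts P Q r x u v d ↔ ENNReal.ofReal (u (state P Q r x v d).index)
      ≤ nodeBeta P r x (state P Q r x v d).index (x (state P Q r x v d).index) := by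
  obtain ⟨h1, -, -, -, hb⟩ := state_invariant hr hQ hr1 hu hreg d hrej
  rw [Accepts, hb _ (hreg.mem_cell _ (Nat.one_le_two_pow.trans h1))]

end State

theorem exists_tail_lt [IsFiniteMeasure P] (hr : Measurable r) (hfin : ∫⁻ y, r y ∂P ≠ ∞)
    {ε : ℝ≥0∞} (hε : ε ≠ 0) : ∃ N : ℕ, tail P r N < ε := by
  have h : Filter.Tendsto (fun N : ℕ => tail P r N) Filter.atTop (nhds (∫⁻ _, 0 ∂P)) := by
    refine tendsto_lintegral_of_dominated_convergence r (fun N => hr.sub measurable_const)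
      (fun N => .of_forall fun y => tsub_le_self) hfin ?_
    filter_upwards [ae_lt_top hr hfin] with y hy
    obtain ⟨N, hN⟩ := ENNReal.exists_nat_gt hy.ne
    refine tendsto_const_nhds.congr' ?_
    filter_upwards [Filter.eventually_ge_atTop N] with k hk
    exact (tsub_eq_zero_of_le (hN.le.trans (by exact_mod_cast hk))).symm
  rw [lintegral_zero] at h
  exact (h.eventually_lt_const (pos_iff_ne_zero.2 hε)).exists

/-- Along an infinite search path the levels increase by at least the remaining mass, so that the
remaining mass tends to zero. -/
theorem exists_tail_lt_of_add_le [IsFiniteMeasure P] (hr : Measurable r)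
    (hfin : ∫⁻ y, r y ∂P ≠ ∞) {a : ℕ → ℝ≥0∞} (ha : ∀ d, a d + tail P r (a d) ≤ a (d + 1))
    {ε : ℝ≥0∞} (hε : ε ≠ 0) : ∃ D, ∀ d ≥ D, tail P r (a d) < ε := by
  have hmono : Monotone a := monotone_nat_of_le_succ fun d => le_self_add.trans (ha d)
  suffices h : ∃ D, tail P r (a D) < ε by
    obtain ⟨D, hD⟩ := h
    exact ⟨D, fun d hd => (tail_antitone (hmono hd)).trans_lt hD⟩
  by_contra! hc
  obtain ⟨N, hN⟩ := exists_tail_lt hr hfin hε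
  have hlow : ∀ d : ℕ, d * ε ≤ a d := by
    intro d
    induction d with
    | zero => simp
    | succ d ih =>
      push_cast
      rw [add_mul, one_mul]
      exact (add_le_add ih (hc d)).trans (ha d)
  obtain ⟨d, hd⟩ := ENNReal.exists_nat_mul_gt hε (ENNReal.natCast_ne_top N)
  exact absurd hN (not_lt.2 ((hc d).trans (tail_antitone (hd.le.trans (hlow d)))))

/-! ### Uniform splits -/

theorem measure_le_of_forall_Iic_le (ρ : Measure ℝ) [IsFiniteMeasure ρ] {A : Set ℝ}
    (hA : MeasurableSet A) {c : ℝ≥0∞} (h : ∀ a ∈ A, ρ (Iic a) ≤ c) : ρ A ≤ c := by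
  by_contra! hc
  obtain ⟨K, hKA, hK, hcK⟩ := hA.exists_lt_isCompact hc
  rcases K.eq_empty_or_nonempty with rfl | hne
  · simp at hcK
  · obtain ⟨a, ha⟩ := hK.exists_isGreatest hne
    exact absurd hcK (not_lt.2 ((measure_mono ha.2).trans (h a (hKA ha.1))))

theorem measure_le_of_forall_Ici_le (ρ : Measure ℝ) [IsFiniteMeasure ρ] {A : Set ℝ}
    (hA : MeasurableSet A) {c : ℝ≥0∞} (h : ∀ a ∈ A, ρ (Ici a) ≤ c) : ρ A ≤ c := by
  by_contra! hc
  obtain ⟨K, hKA, hK, hcK⟩ := hA.exists_lt_isCompact hc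
  rcases K.eq_empty_or_nonempty with rfl | hne
  · simp at hcK
  · obtain ⟨a, ha⟩ := hK.exists_isLeast hne
    exact absurd hcK (not_lt.2 ((measure_mono ha.2).trans (h a (hKA ha.1))))

theorem real_Ioi_eq (ρ : Measure ℝ) [IsFiniteMeasure ρ] (x : ℝ) :
    ρ.real (Ioi x) = ρ.real univ - ρ.real (Iic x) := by
  rw [← compl_Iic, measureReal_compl measurableSet_Iic]

/-- The probability integral transform for a finite atomless measure `ρ`: the mass to the left of a
`ρ`-distributed point is uniform on `[0, ρ ℝ]`. -/
theorem map_real_Iic_eq (ρ : Measure ℝ) [IsFiniteMeasure ρ] [NullSingletonClass ρ] :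
    ρ.map (fun x => ρ.real (Iic x)) = volume.restrict (Icc 0 (ρ.real univ)) := by
  set F : ℝ → ℝ := fun x => ρ.real (Iic x) with hF
  set p := ρ.real univ with hp
  have hmono : Monotone F := fun a b h => measureReal_mono (Iic_subset_Iic.2 h)
  have hmeas : Measurable F := hmono.measurable
  have hFp : ∀ x, F x ≤ p := fun x => measureReal_mono (subset_univ _)
  have hlt : ∀ t, 0 ≤ t → ρ.real {x | F x < t} ≤ t := by
    intro t ht
    refine ENNReal.toReal_le_of_le_ofReal ht (measure_le_of_forall_Iic_le ρ
      (measurableSet_lt hmeas measurable_const) fun a ha => ?_)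
    exact (ENNReal.le_ofReal_iff_toReal_le (measure_ne_top _ _) ht).2 (le_of_lt ha)
  have hgt : ∀ t, t ≤ p → ρ.real {x | t < F x} ≤ p - t := by
    intro t ht
    refine ENNReal.toReal_le_of_le_ofReal (by linarith) (measure_le_of_forall_Ici_le ρ
      (measurableSet_lt measurable_const hmeas) fun a ha => ?_)
    refine (ENNReal.le_ofReal_iff_toReal_le (measure_ne_top _ _) (by linarith)).2 ?_
    have h1 : ρ.real (Ici a) = ρ.real (Ioi a) := measureReal_congr Ioi_ae_eq_Ici.symm
    change ρ.real (Ici a) ≤ p - t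
    rw [h1, real_Ioi_eq]
    have : t < F a := ha
    linarith
  refine Measure.ext_of_Iic _ _ fun t => ?_
  rw [Measure.map_apply hmeas measurableSet_Iic, Measure.restrict_apply measurableSet_Iic]
  have hpre : F ⁻¹' Iic t = {x | F x ≤ t} := rfl
  rcases lt_or_ge t 0 with ht | ht
  · have h1 : F ⁻¹' Iic t = ∅ := by
      ext x
      have : 0 ≤ F x := measureReal_nonneg
      simp only [mem_preimage, mem_Iic, mem_empty_iff_false, iff_false, not_le]
      linarith
    have h2 : Iic t ∩ Icc 0 p = ∅ := by
      ext y
      simp only [mem_inter_iff, mem_Iic, mem_Icc, mem_empty_iff_false, iff_false]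
      rintro ⟨h, h', -⟩
      linarith
    rw [h1, h2, measure_empty, measure_empty]
  · rcases le_total p t with hpt | hpt
    · have h1 : F ⁻¹' Iic t = univ := eq_univ_of_forall fun x => (hFp x).trans hpt
      have h2 : Iic t ∩ Icc 0 p = Icc 0 p :=
        inter_eq_right.2 fun y hy => hy.2.trans hpt
      rw [h1, h2, Real.volume_Icc, sub_zero, hp, ofReal_measureReal]
    · have h2 : Iic t ∩ Icc 0 p = Icc 0 t := by
        ext y
        simp only [mem_inter_iff, mem_Iic, mem_Icc]
        constructor
        · rintro ⟨h, h', -⟩; exact ⟨h', h⟩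
        · rintro ⟨h, h'⟩; exact ⟨h', h, h'.trans hpt⟩
      rw [h2, Real.volume_Icc, sub_zero, ← ofReal_measureReal]
      congr 1
      apply le_antisymm
      · refine le_of_forall_gt_imp_ge_of_dense fun s hs => ?_
        refine (measureReal_mono fun x hx => ?_).trans (hlt s (ht.trans hs.le))
        exact lt_of_le_of_lt hx hs
      · have h3 : ρ.real {x | F x ≤ t} + ρ.real {x | t < F x} = p := by
          have : {x | t < F x} = {x | F x ≤ t}ᶜ := by ext; simp
          rw [this, measureReal_add_measureReal_compl (measurableSet_le hmeas measurable_const)]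
        have := hgt t hpt
        rw [hpre]
        linarith

theorem lintegral_comp_real_Iic (ρ : Measure ℝ) [IsFiniteMeasure ρ] [NullSingletonClass ρ]
    {φ : ℝ → ℝ≥0∞} (hφ : Measurable φ) :
    ∫⁻ x, φ (ρ.real (Iic x)) ∂ρ = ∫⁻ t in Icc 0 (ρ.real univ), φ t := by
  have hmeas : Measurable (fun x => ρ.real (Iic x)) :=
    Monotone.measurable fun a b h => measureReal_mono (Iic_subset_Iic.2 h)
  rw [← map_real_Iic_eq, lintegral_map hφ hmeas]

theorem lintegral_comp_real_Ioi (ρ : Measure ℝ) [IsFiniteMeasure ρ] [NullSingletonClass ρ]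
    {φ : ℝ → ℝ≥0∞} (hφ : Measurable φ) :
    ∫⁻ x, φ (ρ.real (Ioi x)) ∂ρ = ∫⁻ t in Icc 0 (ρ.real univ), φ t := by
  simp_rw [real_Ioi_eq]
  rw [lintegral_comp_real_Iic ρ (φ := fun t => φ (ρ.real univ - t)) (by fun_prop),
    ← lintegral_indicator measurableSet_Icc, ← lintegral_indicator measurableSet_Icc,
    ← lintegral_sub_left_eq_self ((Icc 0 (ρ.real univ)).indicator φ) (ρ.real univ)]
  refine lintegral_congr fun t => ?_
  simp only [indicator, mem_Icc, sub_nonneg, sub_le_self_iff]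
  exact if_congr and_comm rfl rfl

/-! ### The conditional law of the variables at a node -/

theorem cell_of_two_le (x : ℕ → ℝ) {n : ℕ} (hn : 2 ≤ n) :
    cell x n = cell x (n / 2) ∩ (if Even n then Iic (x (n / 2)) else Ioi (x (n / 2))) := by
  obtain ⟨k, rfl⟩ : ∃ k, n = k + 2 := ⟨n - 2, by omega⟩
  have h : Even (k + 2) ↔ Even k := by simp [Nat.even_add]
  rw [cell]
  simp only [h]
  split_ifs <;> rfl

/-- A cell depends only on the split points with smaller index. -/
theorem cell_congr {x x' : ℕ → ℝ} (n : ℕ) (h : ∀ m < n, x m = x' m) : cell x n = cell x' n := by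
  induction n using Nat.strong_induction_on with
  | _ n ih =>
    match n with
    | 0 => simp [cell]
    | 1 => simp [cell]
    | n + 2 =>
      rw [cell_of_two_le x (by omega), cell_of_two_le x' (by omega),
        ih _ (by omega) fun m hm => h m (by omega), h _ (by omega)]

theorem measurableSet_mem_cell (n : ℕ) :
    MeasurableSet {p : (ℕ → ℝ) × ℝ | p.2 ∈ cell p.1 n} := by
  induction n using Nat.strong_induction_on with
  | _ n ih =>
    match n with
    | 0 => simp [cell]
    | 1 => simp [cell]
    | n + 2 =>
      have h1 : Measurable fun p : (ℕ → ℝ) × ℝ => p.1 ((n + 2) / 2) := by fun_prop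
      simp only [cell]
      split_ifs
      · exact (ih _ (by omega)).inter (measurableSet_le measurable_snd h1)
      · exact (ih _ (by omega)).inter (measurableSet_lt h1 measurable_snd)

theorem measurableSet_mem_cell_comp {β : Type*} [MeasurableSpace β] {x : β → ℕ → ℝ}
    (hx : Measurable x) {n : β → ℕ} (hn : Measurable n) :
    MeasurableSet {p : β × ℝ | p.2 ∈ cell (x p.1) (n p.1)} := by
  have : {p : β × ℝ | p.2 ∈ cell (x p.1) (n p.1)}
      = ⋃ k, {p : β × ℝ | n p.1 = k} ∩ {p : β × ℝ | p.2 ∈ cell (x p.1) k} := by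
    ext p; simp
  rw [this]
  refine MeasurableSet.iUnion fun k => ?_
  refine (measurableSet_eq_fun (hn.comp measurable_fst) measurable_const).inter ?_
  exact ((hx.comp measurable_fst).prodMk measurable_snd) (measurableSet_mem_cell k)

theorem measurable_setLIntegral_cell {β : Type*} [MeasurableSpace β] (P : Measure ℝ) [SFinite P]
    {x : β → ℕ → ℝ} (hx : Measurable x) {n : β → ℕ} (hn : Measurable n) {f : β → ℝ → ℝ≥0∞}
    (hf : Measurable (Function.uncurry f)) :
    Measurable fun b => ∫⁻ a in cell (x b) (n b), f b a ∂P := by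
  have hset := measurableSet_mem_cell_comp hx hn
  have h := (hf.indicator hset).lintegral_prod_right' (ν := P)
  convert h using 2 with b
  rw [← lintegral_indicator (measurableSet_cell _ _)]
  rfl

theorem measurable_measure_cell {β : Type*} [MeasurableSpace β] (P : Measure ℝ) [SFinite P]
    {x : β → ℕ → ℝ} (hx : Measurable x) {n : β → ℕ} (hn : Measurable n) :
    Measurable fun b => P (cell (x b) (n b)) := by
  have := measurable_setLIntegral_cell P hx hn (f := fun _ _ => 1) measurable_const
  simpa using this

theorem lintegral_cond (P : Measure ℝ) (S : Set ℝ) (f : ℝ → ℝ≥0∞) :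
    ∫⁻ a, f a ∂P[|S] = (P S)⁻¹ * ∫⁻ a in S, f a ∂P := by
  rw [ProbabilityTheory.cond, lintegral_smul_measure, smul_eq_mul]

/-- The sequence that agrees with a given one before `n` and vanishes from `n` on. -/
def extendZero (n : ℕ) (p : Fin n → ℝ) : ℕ → ℝ := fun k => if h : k < n then p ⟨k, h⟩ else 0

theorem measurable_extendZero (n : ℕ) : Measurable (extendZero n) := by
  refine measurable_pi_iff.2 fun k => ?_
  unfold extendZero
  split_ifs
  · exact measurable_pi_apply _
  · exact measurable_const

/-- Integration of a function of `(A, B, A', B')`, where `(A, A')` is independent of `(B, B')`, `B`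
is independent of `B'`, and `A'` has the conditional law `ρ A` given `A`. -/
theorem lintegral_eq_of_condDistrib {Ω S T : Type*} [MeasurableSpace Ω] [MeasurableSpace S]
    [MeasurableSpace T] {μ : Measure Ω} [IsProbabilityMeasure μ] {A : Ω → S} {B : Ω → T}
    {A' B' : Ω → ℝ} (hA : Measurable A) (hB : Measurable B) (hA' : Measurable A')
    (hB' : Measurable B') (hind : IndepFun (fun ω => (B ω, B' ω)) (fun ω => (A ω, A' ω)) μ)
    (hindB : IndepFun B B' μ) {ρ : S → Measure ℝ}
    (hρ : ∀ᵐ ω ∂μ, condDistrib A' A μ (A ω) = ρ (A ω)) {G : T → ℝ → S → ℝ → ℝ≥0∞}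
    (hG : Measurable fun p : (T × ℝ) × (S × ℝ) => G p.1.1 p.1.2 p.2.1 p.2.2)
    (hH : Measurable fun s : (T × S) × ℝ => ∫⁻ a, G s.1.1 s.2 s.1.2 a ∂ρ s.1.2) :
    ∫⁻ ω, G (B ω) (B' ω) (A ω) (A' ω) ∂μ
      = ∫⁻ ω, ∫⁻ b, ∫⁻ a, G (B ω) b (A ω) a ∂ρ (A ω) ∂(μ.map B') ∂μ := by
  have hm1 := (indepFun_iff_map_prod_eq_prod_map_map (hB.prodMk hB').aemeasurable
    (hA.prodMk hA').aemeasurable).1 hind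
  have hm2 := (indepFun_iff_map_prod_eq_prod_map_map hB.aemeasurable hB'.aemeasurable).1 hindB
  have hm3 : μ.map (fun ω => (B ω, A ω)) = (μ.map B).prod (μ.map A) :=
    (indepFun_iff_map_prod_eq_prod_map_map hB.aemeasurable hA.aemeasurable).1
      (hind.comp measurable_fst measurable_fst)
  have hcond := compProd_map_condDistrib (mβ := ‹MeasurableSpace S›) (X := A) (μ := μ) hA'.aemeasurable
  have : IsProbabilityMeasure (μ.map B) := Measure.isProbabilityMeasure_map hB.aemeasurable
  have : IsProbabilityMeasure (μ.map B') := Measure.isProbabilityMeasure_map hB'.aemeasurable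
  have : IsProbabilityMeasure (μ.map A) := Measure.isProbabilityMeasure_map hA.aemeasurable
  obtain ⟨H, hHdef⟩ : ∃ H : T → S → ℝ → ℝ≥0∞, H = fun q p b => ∫⁻ a, G q b p a ∂ρ p := ⟨_, rfl⟩
  have hH' : Measurable fun s : (T × S) × ℝ => H s.1.1 s.1.2 s.2 := by rw [hHdef]; exact hH
  have hinner : ∀ q b, ∫⁻ p, ∫⁻ a, G q b p a ∂(condDistrib A' A μ p) ∂(μ.map A)
      = ∫⁻ p, H q p b ∂(μ.map A) := by
    intro q b
    have hGq : Measurable fun p : S × ℝ => G q b p.1 p.2 :=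
      hG.comp (measurable_prodMk_left (x := (q, b)))
    have hm' : Measurable fun p => H q p b :=
      hH'.comp ((measurable_prodMk_left (x := q)).prodMk measurable_const)
    rw [lintegral_map hGq.lintegral_kernel_prod_right' hA, lintegral_map hm' hA, hHdef]
    refine lintegral_congr_ae ?_
    filter_upwards [hρ] with ω hω
    rw [hω]
  calc ∫⁻ ω, G (B ω) (B' ω) (A ω) (A' ω) ∂μ
      = ∫⁻ p, G p.1.1 p.1.2 p.2.1 p.2.2 ∂(μ.map fun ω => ((B ω, B' ω), (A ω, A' ω))) :=
        (lintegral_map hG ((hB.prodMk hB').prodMk (hA.prodMk hA'))).symm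
    _ = ∫⁻ q, ∫⁻ b, ∫⁻ p, H q p b ∂(μ.map A) ∂(μ.map B') ∂(μ.map B) := by
        rw [hm1, lintegral_prod _ hG.aemeasurable, hm2, ← hcond]
        have h1 : ∀ q : T × ℝ, ∫⁻ y, G q.1 q.2 y.1 y.2 ∂(μ.map A ⊗ₘ condDistrib A' A μ)
            = ∫⁻ p, H q.1 p q.2 ∂(μ.map A) := fun q =>
          (Measure.lintegral_compProd (hG.comp (measurable_prodMk_left (x := q)))).trans
            (hinner q.1 q.2)
        rw [lintegral_congr h1]
        have h2 : Measurable fun q : T × ℝ => ∫⁻ p, H q.1 p q.2 ∂(μ.map A) :=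
          Measurable.lintegral_prod_right' (f := fun s : (T × ℝ) × S => H s.1.1 s.2 s.1.2)
            (hH'.comp (((measurable_fst.comp measurable_fst).prodMk measurable_snd).prodMk
              (measurable_snd.comp measurable_fst)))
        exact lintegral_prod _ h2.aemeasurable
    _ = ∫⁻ q, ∫⁻ p, ∫⁻ b, H q p b ∂(μ.map B') ∂(μ.map A) ∂(μ.map B) := by
        refine lintegral_congr fun q => lintegral_lintegral_swap ?_
        exact (hH'.comp ((measurable_const.prodMk measurable_snd).prodMk
          measurable_fst)).aemeasurable
    _ = ∫⁻ ω, ∫⁻ b, H (B ω) (A ω) b ∂(μ.map B') ∂μ := by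
        have hm : Measurable fun s : T × S => ∫⁻ b, H s.1 s.2 b ∂(μ.map B') :=
          hH'.lintegral_prod_right'
        have h4 := lintegral_map (μ := μ) hm (hB.prodMk hA)
        rw [hm3, lintegral_prod _ hm.aemeasurable] at h4
        exact h4
    _ = _ := by rw [hHdef]

/-- Given the samples and uniform variates with index below `n`, the pair `(X n, U n)` has law
`P[|Z_n] ⊗ uniform`. -/
theorem IsSampleSplittingSource.lintegral_node {Ω : Type*} [MeasurableSpace Ω] {μ : Measure Ω}
    [IsProbabilityMeasure μ] {P : Measure ℝ} [IsFiniteMeasure P] {X U V : ℕ → Ω → ℝ}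
    (h : IsSampleSplittingSource μ P X U V) {n : ℕ} (hn : 1 ≤ n)
    {Φ : (ℕ → ℝ) → (ℕ → ℝ) → ℝ → ℝ → ℝ≥0∞}
    (hΦ : Measurable fun p : ((ℕ → ℝ) × (ℕ → ℝ)) × ℝ × ℝ => Φ p.1.1 p.1.2 p.2.1 p.2.2)
    (hdep : ∀ x x' u u', (∀ m < n, x m = x' m) → (∀ m < n, u m = u' m) → Φ x u = Φ x' u') :
    ∫⁻ ω, Φ (fun k => X k ω) (fun k => U k ω) (X n ω) (U n ω) ∂μ
      = ∫⁻ ω, ∫⁻ b in Icc (0 : ℝ) 1, ∫⁻ a, Φ (fun k => X k ω) (fun k => U k ω) a b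
          ∂P[|cells X ω n] ∂volume ∂μ := by
  set E := extendZero n
  have hE := measurable_extendZero n
  let Xp : Ω → Fin n → ℝ := fun ω m => X m ω
  let Up : Ω → Fin n → ℝ := fun ω m => U m ω
  have hXp : Measurable Xp := measurable_pi_iff.2 fun m => h.measurable_X m
  have hUp : Measurable Up := measurable_pi_iff.2 fun m => h.measurable_U m
  have hXn := h.measurable_X n
  have hUn := h.measurable_U n
  have hEX : ∀ ω, ∀ m < n, X m ω = E (Xp ω) m := fun ω m hm => by simp [E, extendZero, hm, Xp]
  have hEU : ∀ ω, ∀ m < n, U m ω = E (Up ω) m := fun ω m hm => by simp [E, extendZero, hm, Up]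
  have hΦE : ∀ ω, Φ (fun k => X k ω) (fun k => U k ω) = Φ (E (Xp ω)) (E (Up ω)) :=
    fun ω => hdep _ _ _ _ (hEX ω) (hEU ω)
  have hcell : ∀ ω, cells X ω n = cell (E (Xp ω)) n := fun ω => cell_congr n (hEX ω)
  simp_rw [hΦE, hcell]
  -- independence of the past samples, the past uniform variates, and the uniform variate at `n`
  have hind1 : IndepFun (fun ω => (Up ω, U n ω)) (fun ω => (Xp ω, X n ω)) μ := by
    have := h.indep_X.symm.comp
      (φ := fun p : (ℕ → ℝ) × (ℕ → ℝ) => ((fun m : Fin n => p.1 m), p.1 n))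
      (ψ := fun p : ℕ → ℝ => ((fun m : Fin n => p m), p n)) (by fun_prop) (by fun_prop)
    exact this
  have hind2 : IndepFun Up (U n) μ := by
    have hd : Disjoint ((Finset.range n).image (Sum.inl : ℕ → ℕ ⊕ ℕ)) {Sum.inl n} := by
      simp
    have h' := h.indep_UV.indepFun_finset _ _ hd (by
      rintro (i | i)
      · exact h.measurable_U i
      · exact h.measurable_V i)
    have hmem : ∀ m : Fin n, (Sum.inl (m : ℕ) : ℕ ⊕ ℕ) ∈ (Finset.range n).image Sum.inl := by
      intro m; simp
    let φ : (((Finset.range n).image (Sum.inl : ℕ → ℕ ⊕ ℕ) : Finset (ℕ ⊕ ℕ)) → ℝ) → Fin n → ℝ :=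
      fun p m => p ⟨Sum.inl m, hmem m⟩
    let ψ : (({Sum.inl n} : Finset (ℕ ⊕ ℕ)) → ℝ) → ℝ := fun p => p ⟨Sum.inl n, by simp⟩
    have hφ : Measurable φ := by fun_prop
    have hψ : Measurable ψ := by fun_prop
    exact h'.comp hφ hψ
  rw [← h.law_U n]
  refine lintegral_eq_of_condDistrib (ρ := fun p => P[|cell (E p) n])
    (G := fun q b p a => Φ (E p) (E q) a b) hXp hUp hXn hUn hind1 hind2 ?_ ?_ ?_
  · filter_upwards [h.condLaw_X n hn] with ω hω
    exact hω.trans (by rw [hcell])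
  · exact hΦ.comp (((hE.comp (measurable_fst.comp measurable_snd)).prodMk
      (hE.comp (measurable_fst.comp measurable_fst))).prodMk
      ((measurable_snd.comp measurable_snd).prodMk (measurable_snd.comp measurable_fst)))
  · simp_rw [lintegral_cond]
    have hEs : Measurable fun s : ((Fin n → ℝ) × (Fin n → ℝ)) × ℝ => E s.1.2 :=
      hE.comp (measurable_snd.comp measurable_fst)
    have hEs' : Measurable fun s : ((Fin n → ℝ) × (Fin n → ℝ)) × ℝ => E s.1.1 :=
      hE.comp (measurable_fst.comp measurable_fst)
    refine Measurable.mul (Measurable.inv (measurable_measure_cell P hEs measurable_const))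
      (measurable_setLIntegral_cell P hEs measurable_const ?_)
    exact hΦ.comp (((hEs.comp measurable_fst).prodMk (hEs'.comp measurable_fst)).prodMk
      (measurable_snd.prodMk (measurable_snd.comp measurable_fst)))

/-! ### Sums over the nodes of the binary tree -/

/-- If the potential `b` of each node pays for its cost `a` and for the potentials of its two
children, then `b 1` pays for the first `N` nodes and for the potentials of the nodes
`N + 1, …, 2 N + 1`, which are the children of the first `N` nodes that are not among them. -/
theorem sum_add_sum_frontier_le {a b : ℕ → ℝ≥0∞}
    (h : ∀ n, 1 ≤ n → a n + (b (2 * n) + b (2 * n + 1)) ≤ b n) (N : ℕ) :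
    ∑ n ∈ Finset.Ico 1 (N + 1), a n + ∑ n ∈ Finset.Ico (N + 1) (2 * N + 2), b n ≤ b 1 := by
  induction N with
  | zero => simp
  | succ N ih =>
    refine le_trans ?_ ih
    rw [Finset.sum_Ico_succ_top (show 1 ≤ N + 1 by omega) a,
      Finset.sum_eq_sum_Ico_succ_bot (show N + 1 < 2 * N + 2 by omega) b,
      show 2 * (N + 1) + 2 = 2 * N + 2 + 1 + 1 by ring,
      Finset.sum_Ico_succ_top (show N + 1 + 1 ≤ 2 * N + 2 + 1 by omega) b,
      Finset.sum_Ico_succ_top (show N + 1 + 1 ≤ 2 * N + 2 by omega) b, add_assoc]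
    refine add_le_add_right ?_ _
    refine le_trans (le_of_eq ?_) (add_le_add_left (h (N + 1) (by omega)) _)
    rw [show 2 * (N + 1) = 2 * N + 2 by ring]
    ring

theorem tsum_le_of_potential {a b : ℕ → ℝ≥0∞}
    (h : ∀ n, 1 ≤ n → a n + (b (2 * n) + b (2 * n + 1)) ≤ b n) : ∑' n, a (n + 1) ≤ b 1 := by
  refine ENNReal.tsum_le_of_sum_range_le fun N => ?_
  refine le_trans ?_ (le_self_add.trans (sum_add_sum_frontier_le h N))
  rw [Finset.sum_Ico_eq_sum_range]
  simp [add_comm]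

theorem sum_depth_le_of_potential {a b : ℕ → ℝ≥0∞}
    (h : ∀ n, 1 ≤ n → a n + (b (2 * n) + b (2 * n + 1)) ≤ b n) (d : ℕ) :
    ∑ n ∈ Finset.Ico (2 ^ d) (2 ^ (d + 1)), b n ≤ b 1 := by
  have := le_add_self.trans (sum_add_sum_frontier_le h (2 ^ d - 1))
  have hd : 1 ≤ 2 ^ d := Nat.one_le_two_pow
  rwa [show 2 ^ d - 1 + 1 = 2 ^ d by omega,
    show 2 * (2 ^ d - 1) + 2 = 2 ^ (d + 1) by rw [pow_succ]; omega] at this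

/-! ### Almost sure properties of the partition -/

section Source

variable {Ω : Type*} [MeasurableSpace Ω] {μ : Measure Ω} [IsProbabilityMeasure μ] {P : Measure ℝ}
  {X U V : ℕ → Ω → ℝ}

theorem measurable_measure_cell_inter [SFinite P] (n : ℕ) {S : ℝ → Set ℝ}
    (hS : MeasurableSet {p : ℝ × ℝ | p.2 ∈ S p.1}) :
    Measurable fun p : (ℕ → ℝ) × ℝ => P (cell p.1 n ∩ S p.2) := by
  have h := measurable_setLIntegral_cell P (β := (ℕ → ℝ) × ℝ) measurable_fst
    (n := fun _ => n) measurable_const (f := fun p a => (S p.2).indicator (fun _ => 1) a) (by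
      have h1 : MeasurableSet {q : ((ℕ → ℝ) × ℝ) × ℝ | q.2 ∈ S q.1.2} :=
        (measurable_snd.comp measurable_fst).prodMk measurable_snd hS
      exact (measurable_const (a := (1 : ℝ≥0∞))).indicator h1)
  convert h using 2 with p
  have hm : MeasurableSet (S p.2) := measurable_prodMk_left (x := p.2) hS
  rw [lintegral_indicator hm, Measure.restrict_restrict hm, setLIntegral_one, inter_comm]

theorem measurableSet_mem_Iic : MeasurableSet {p : ℝ × ℝ | p.2 ∈ Iic p.1} :=
  measurableSet_le measurable_snd measurable_fst

theorem measurableSet_mem_Ioi : MeasurableSet {p : ℝ × ℝ | p.2 ∈ Ioi p.1} :=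
  measurableSet_lt measurable_fst measurable_snd

/-- Integration over the split point `X n` alone. -/
theorem IsSampleSplittingSource.lintegral_split [IsFiniteMeasure P]
    (h : IsSampleSplittingSource μ P X U V) {n : ℕ} (hn : 1 ≤ n) {Φ : (ℕ → ℝ) → ℝ → ℝ≥0∞}
    (hΦ : Measurable fun p : (ℕ → ℝ) × ℝ => Φ p.1 p.2)
    (hdep : ∀ x x', (∀ m < n, x m = x' m) → Φ x = Φ x') :
    ∫⁻ ω, Φ (fun k => X k ω) (X n ω) ∂μ
      = ∫⁻ ω, (P (cells X ω n))⁻¹ * ∫⁻ a in cells X ω n, Φ (fun k => X k ω) a ∂P ∂μ := by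
  rw [h.lintegral_node hn (Φ := fun x _ a _ => Φ x a)
    (hΦ.comp ((measurable_fst.comp measurable_fst).prodMk (measurable_fst.comp measurable_snd)))
    fun x x' _ _ hx _ => by rw [hdep x x' hx]]
  simp [lintegral_cond]

theorem IsSampleSplittingSource.measurable_path (h : IsSampleSplittingSource μ P X U V) :
    Measurable fun ω => ((fun k => X k ω), (fun k => U k ω)) :=
  (measurable_pi_iff.2 h.measurable_X).prodMk (measurable_pi_iff.2 h.measurable_U)

theorem IsSampleSplittingSource.ae_split [IsFiniteMeasure P]
    (h : IsSampleSplittingSource μ P X U V) {n : ℕ} (hn : 1 ≤ n) {B : Set ((ℕ → ℝ) × ℝ)}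
    (hB : MeasurableSet B)
    (hdep : ∀ x x' a, (∀ m < n, x m = x' m) → ((x, a) ∈ B ↔ (x', a) ∈ B))
    (h0 : ∀ x, ∀ᵐ a ∂(P.restrict (cell x n)), (x, a) ∉ B) :
    ∀ᵐ ω ∂μ, ((fun k => X k ω), X n ω) ∉ B := by
  have hi := h.lintegral_split hn (Φ := fun x a => B.indicator (fun _ => 1) (x, a))
    (measurable_const.indicator hB) fun x x' hx => by
      funext a
      by_cases ha : (x, a) ∈ B
      · rw [indicator_of_mem ha, indicator_of_mem ((hdep x x' a hx).1 ha)]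
      · rw [indicator_of_notMem ha, indicator_of_notMem (mt (hdep x x' a hx).2 ha)]
  have hz : ∀ ω, ∫⁻ a in cells X ω n, B.indicator (fun _ => 1) ((fun k => X k ω), a) ∂P
      = 0 := by
    intro ω
    rw [lintegral_congr_ae (g := fun _ => 0), lintegral_zero]
    filter_upwards [h0 fun k => X k ω] with a ha
    exact indicator_of_notMem ha _
  simp only [hz, mul_zero, lintegral_zero] at hi
  have hm : Measurable fun ω => B.indicator (fun _ => (1 : ℝ≥0∞)) ((fun k => X k ω), X n ω) :=
    (measurable_const.indicator hB).comp
      ((measurable_pi_iff.2 h.measurable_X).prodMk (h.measurable_X n))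
  rw [lintegral_eq_zero_iff hm] at hi
  filter_upwards [hi] with ω hω hmem
  rw [Pi.zero_apply, indicator_of_mem hmem] at hω
  exact one_ne_zero hω

theorem IsSampleSplittingSource.ae_mem_cell [IsFiniteMeasure P]
    (h : IsSampleSplittingSource μ P X U V) : ∀ᵐ ω ∂μ, ∀ n, 1 ≤ n → X n ω ∈ cells X ω n := by
  refine ae_all_iff.2 fun n => Filter.eventually_imp_distrib_left.2 fun hn => ?_
  have := h.ae_split hn (measurableSet_mem_cell n).compl
    (fun x x' a hx => by simp [cell_congr n hx])
    (fun x => by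
      filter_upwards [ae_restrict_mem (measurableSet_cell x n)] with a ha
      simpa using ha)
  filter_upwards [this] with ω hω
  simpa [cells] using hω

theorem ae_measure_inter_Iic_ne_zero [IsFiniteMeasure P] [NullSingletonClass P] (S : Set ℝ) :
    ∀ᵐ a ∂(P.restrict S), P (S ∩ Iic a) ≠ 0 ∧ P (S ∩ Ioi a) ≠ 0 := by
  have : NullSingletonClass (P.restrict S) :=
    ⟨fun a => le_antisymm ((Measure.restrict_apply_le _ _).trans (measure_singleton a).le) zero_le⟩
  have hφ : Measurable (({0} : Set ℝ).indicator fun _ => (1 : ℝ≥0∞)) :=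
    measurable_const.indicator (measurableSet_singleton 0)
  have h1 := lintegral_comp_real_Iic (P.restrict S) hφ
  have h2 := lintegral_comp_real_Ioi (P.restrict S) hφ
  have h0 : ∫⁻ t in Icc 0 ((P.restrict S).real univ),
      ({0} : Set ℝ).indicator (fun _ => (1 : ℝ≥0∞)) t = 0 := by
    rw [lintegral_indicator_const (measurableSet_singleton 0)]
    simp
  have hm1 : Measurable fun x => (P.restrict S).real (Iic x) :=
    Monotone.measurable fun a b h => measureReal_mono (Iic_subset_Iic.2 h)
  have hm2 : Measurable fun x => (P.restrict S).real (Ioi x) :=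
    Antitone.measurable fun a b h => measureReal_mono (Ioi_subset_Ioi h)
  rw [h0] at h1 h2
  replace h1 := (lintegral_eq_zero_iff (hφ.comp hm1)).1 h1
  replace h2 := (lintegral_eq_zero_iff (hφ.comp hm2)).1 h2
  filter_upwards [h1, h2] with a h1 h2
  constructor
  · intro hz
    rw [Function.comp_apply, Pi.zero_apply, indicator_of_mem] at h1
    · exact one_ne_zero h1
    · rw [mem_singleton_iff, measureReal_restrict_apply measurableSet_Iic, inter_comm,
        measureReal_def, hz, ENNReal.toReal_zero]
  · intro hz
    rw [Function.comp_apply, Pi.zero_apply, indicator_of_mem] at h2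
    · exact one_ne_zero h2
    · rw [mem_singleton_iff, measureReal_restrict_apply measurableSet_Ioi, inter_comm,
        measureReal_def, hz, ENNReal.toReal_zero]

theorem IsSampleSplittingSource.ae_measure_cell_ne_zero [IsProbabilityMeasure P]
    [NullSingletonClass P] (h : IsSampleSplittingSource μ P X U V) :
    ∀ᵐ ω ∂μ, ∀ n, 1 ≤ n → P (cells X ω n) ≠ 0 := by
  have key : ∀ᵐ ω ∂μ, ∀ n, 1 ≤ n →
      P (cells X ω n ∩ Iic (X n ω)) ≠ 0 ∧ P (cells X ω n ∩ Ioi (X n ω)) ≠ 0 := by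
    refine ae_all_iff.2 fun n => Filter.eventually_imp_distrib_left.2 fun hn => ?_
    have hm1 := measurable_measure_cell_inter (P := P) n measurableSet_mem_Iic
    have hm2 := measurable_measure_cell_inter (P := P) n measurableSet_mem_Ioi
    have := h.ae_split hn (((measurableSet_eq_fun hm1 measurable_const).compl.inter
        (measurableSet_eq_fun hm2 measurable_const).compl).compl)
      (fun x x' a hx => by simp [cell_congr n hx])
      (fun x => by
        filter_upwards [ae_measure_inter_Iic_ne_zero (P := P) (cell x n)] with a ha
        simpa using ha)
    filter_upwards [this] with ω hω
    simpa [cells] using hω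
  filter_upwards [key] with ω hω n hn
  rcases Nat.lt_or_ge n 2 with h2 | h2
  · rw [show n = 1 by omega, cells, cell_one]
    simp
  · rw [cells, cell_of_two_le _ h2]
    split_ifs
    · exact (hω (n / 2) (by omega)).1
    · exact (hω (n / 2) (by omega)).2

omit [IsProbabilityMeasure μ] in
theorem ae_mem_Ioc_of_law {W : Ω → ℝ} (hW : Measurable W)
    (hlaw : μ.map W = volume.restrict (Icc 0 1)) : ∀ᵐ ω ∂μ, W ω ∈ Ioc 0 1 := by
  have : ∀ᵐ b ∂(μ.map W), b ∈ Ioc (0 : ℝ) 1 := by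
    rw [hlaw, ← Measure.restrict_congr_set Ioc_ae_eq_Icc]
    exact ae_restrict_mem measurableSet_Ioc
  exact ae_of_ae_map hW.aemeasurable this

theorem IsSampleSplittingSource.ae_regular [IsProbabilityMeasure P] [NullSingletonClass P]
    (h : IsSampleSplittingSource μ P X U V) :
    ∀ᵐ ω ∂μ, Regular P (fun k => X k ω) (fun k => U k ω) (fun k => V k ω) := by
  have hU := ae_all_iff.2 fun n => ae_mem_Ioc_of_law (h.measurable_U n) (h.law_U n)
  have hV := ae_all_iff.2 fun n => ae_mem_Ioc_of_law (h.measurable_V n) (h.law_V n)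
  filter_upwards [h.ae_mem_cell, h.ae_measure_cell_ne_zero, hU, hV] with ω h1 h2 h3 h4
  exact ⟨h1, h2, fun n => (h3 n).1, fun n => (h3 n).2, fun n => (h4 n).1, fun n => (h4 n).2⟩

/-! ### The expected total code weight -/

theorem inv_mul_setLIntegral_totalWeight [IsProbabilityMeasure P] [NullSingletonClass P]
    {S : Set ℝ} (hS0 : P S ≠ 0) :
    (P S)⁻¹ * ∫⁻ a in S, ENNReal.ofReal (totalWeight (P.real (S ∩ Iic a))) ∂P
        = ENNReal.ofReal ((P.real S)⁻¹ * (P.real S ^ 2 / (1 - Real.log (P.real S)))) ∧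
      (P S)⁻¹ * ∫⁻ a in S, ENNReal.ofReal (totalWeight (P.real (S ∩ Ioi a))) ∂P
        = ENNReal.ofReal ((P.real S)⁻¹ * (P.real S ^ 2 / (1 - Real.log (P.real S)))) := by
  have : NullSingletonClass (P.restrict S) :=
    ⟨fun a => le_antisymm ((Measure.restrict_apply_le _ _).trans (measure_singleton a).le) zero_le⟩
  have hp : 0 < P.real S := ENNReal.toReal_pos hS0 (measure_ne_top _ _)
  have hφ : Measurable fun t => ENNReal.ofReal (totalWeight t) :=
    ENNReal.measurable_ofReal.comp measurable_totalWeight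
  have h1 := lintegral_comp_real_Iic (P.restrict S) hφ
  have h2 := lintegral_comp_real_Ioi (P.restrict S) hφ
  rw [measureReal_restrict_apply_univ,
    lintegral_totalWeight measureReal_nonneg measureReal_le_one] at h1 h2
  have hinv : (P S)⁻¹ = ENNReal.ofReal (P.real S)⁻¹ := by
    rw [ENNReal.ofReal_inv_of_pos hp, ofReal_measureReal]
  constructor
  · rw [ENNReal.ofReal_mul (by positivity), ← hinv, ← h1]
    simp_rw [measureReal_restrict_apply measurableSet_Iic, inter_comm]
  · rw [ENNReal.ofReal_mul (by positivity), ← hinv, ← h2]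
    simp_rw [measureReal_restrict_apply measurableSet_Ioi, inter_comm]

theorem IsSampleSplittingSource.measurable_real_cells [IsFiniteMeasure P]
    (h : IsSampleSplittingSource μ P X U V) (n : ℕ) : Measurable fun ω => P.real (cells X ω n) :=
  (measurable_measure_cell P (measurable_pi_iff.2 h.measurable_X) measurable_const).ennreal_toReal

theorem IsSampleSplittingSource.lintegral_tsum_weight_le [IsProbabilityMeasure P]
    [NullSingletonClass P] (h : IsSampleSplittingSource μ P X U V) :
    ∫⁻ ω, ∑' n, ENNReal.ofReal (weight (P.real (cells X ω (n + 1)))) ∂μ ≤ 3 := by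
  have hw : ∀ n, AEMeasurable
      (fun ω => ENNReal.ofReal (weight (P.real (cells X ω (n + 1))))) μ := fun n =>
    (ENNReal.measurable_ofReal.comp
      (measurable_weight.comp (h.measurable_real_cells (n + 1)))).aemeasurable
  rw [lintegral_tsum hw]
  refine (tsum_le_of_potential
    (a := fun n => ∫⁻ ω, ENNReal.ofReal (weight (P.real (cells X ω n))) ∂μ)
    (b := fun n => ∫⁻ ω, ENNReal.ofReal (totalWeight (P.real (cells X ω n))) ∂μ)
    fun n hn => ?_).trans ?_
  · have hmI := measurable_measure_cell_inter (P := P) n measurableSet_mem_Iic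
    have hmO := measurable_measure_cell_inter (P := P) n measurableSet_mem_Ioi
    have e1 := h.lintegral_split hn
      (Φ := fun x a => ENNReal.ofReal (totalWeight (P.real (cell x n ∩ Iic a))))
      (ENNReal.measurable_ofReal.comp (measurable_totalWeight.comp hmI.ennreal_toReal))
      fun x x' hx => by simp only [cell_congr n hx]
    have e2 := h.lintegral_split hn
      (Φ := fun x a => ENNReal.ofReal (totalWeight (P.real (cell x n ∩ Ioi a))))
      (ENNReal.measurable_ofReal.comp (measurable_totalWeight.comp hmO.ennreal_toReal))
      fun x x' hx => by simp only [cell_congr n hx]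
    simp only [cells, cell_left _ hn, cell_right _ hn]
    rw [e1, e2]
    simp only [cells]
    have hmeas : Measurable fun ω => P.real (cell (fun k => X k ω) n) := h.measurable_real_cells n
    have hmeas' : Measurable fun ω => ENNReal.ofReal (weight (P.real (cell (fun k => X k ω) n))) :=
      ENNReal.measurable_ofReal.comp (measurable_weight.comp hmeas)
    have hS : ∀ᵐ ω ∂μ, P (cell (fun k => X k ω) n) ≠ 0 := by
      filter_upwards [h.ae_measure_cell_ne_zero] with ω hω using hω n hn
    rw [lintegral_congr_ae (hS.mono fun ω hω => (inv_mul_setLIntegral_totalWeight hω).1),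
      lintegral_congr_ae (hS.mono fun ω hω => (inv_mul_setLIntegral_totalWeight hω).2),
      ← lintegral_add_left (by fun_prop),
      ← lintegral_add_left hmeas']
    refine (lintegral_congr_ae ?_).le
    filter_upwards [hS] with ω hω
    have hp : 0 < P.real (cell (fun k => X k ω) n) := ENNReal.toReal_pos hω (measure_ne_top _ _)
    have hl := one_le_one_sub_log hp.le (measureReal_le_one (μ := P))
    rw [← weight_add_eq_totalWeight hp, ENNReal.ofReal_add, two_mul, ENNReal.ofReal_add]
    all_goals (try unfold weight); positivity
  · simp only [cells, cell_one, probReal_univ]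
    rw [lintegral_const, measure_univ, mul_one, totalWeight]
    norm_num

end Source

/-! ### The potential of a node -/

/-- The conditional expectation, when the search arrives at level `h`, of `g` at the returned sample
(which has density `(r - h)⁺ / tail h`), plus a bound for the conditional expectation of
`ln (1 / w)`, with `w` the remaining mass at the accepting node. -/
noncomputable def potential (P : Measure ℝ) (r g : ℝ → ℝ≥0∞) (h : ℝ≥0∞) : ℝ≥0∞ :=
  (∫⁻ y, g y * (r y - h) ∂P) / tail P r h + (logPlus (tail P r h)⁻¹ + 1)

/-- The cost of accepting the sample `y` at the node `n`. -/
noncomputable def nodeCost (P : Measure ℝ) (r g : ℝ → ℝ≥0∞) (x : ℕ → ℝ) (n : ℕ) (y : ℝ) : ℝ≥0∞ :=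
  g y + logPlus (tail P r (level P r x n))⁻¹

variable {P : Measure ℝ} {r g : ℝ → ℝ≥0∞} {x : ℕ → ℝ}

theorem nodeAlpha_add (n : ℕ) (y : ℝ) :
    nodeAlpha P r x n y + (r y - nextLevel P r x n) = r y - level P r x n :=
  min_tsub_add_tsub _ _ _

theorem nodeBeta_le_one (n : ℕ) (y : ℝ) : nodeBeta P r x n y ≤ 1 := by
  refine (mul_le_mul_left (min_le_right _ _) _).trans ?_
  rw [div_eq_mul_inv, div_eq_mul_inv, mul_assoc, ← mul_assoc (P (cell x n))⁻¹]
  calc tail P r (level P r x n) * ((P (cell x n))⁻¹ * P (cell x n)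
        * (tail P r (level P r x n))⁻¹)
      ≤ tail P r (level P r x n) * (1 * (tail P r (level P r x n))⁻¹) := by
        gcongr
        exact ENNReal.inv_mul_le_one _
    _ ≤ 1 := by rw [one_mul]; exact ENNReal.mul_inv_le_one _

theorem measurable_nodeAlpha (hr : Measurable r) (n : ℕ) : Measurable (nodeAlpha P r x n) :=
  (hr.sub measurable_const).min measurable_const

/-- The potential pays for acceptance at a node, with probability `nodeBeta`, and for the potential
at its children. -/
theorem potential_step [IsProbabilityMeasure P] (hr : Measurable r) (hg : Measurable g)
    (hr1 : ∫⁻ y, r y ∂P = 1) {n : ℕ} (hP : P (cell x n) ≠ 0)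
    (hincl : ∫⁻ y in cell x n, (r y - level P r x n) ∂P = tail P r (level P r x n)) :
    (P (cell x n))⁻¹ * ∫⁻ y in cell x n, (nodeBeta P r x n y * nodeCost P r g x n y
        + (1 - nodeBeta P r x n y) * potential P r g (nextLevel P r x n)) ∂P
      ≤ potential P r g (level P r x n) := by
  have hnext : ∫⁻ y in cell x n, (r y - nextLevel P r x n) ∂P = tail P r (nextLevel P r x n) :=
    setLIntegral_tsub_eq_tail (measurableSet_cell x n) (le_nextLevel n)
      (ne_top_of_le_ne_top (hr1 ▸ ENNReal.one_ne_top) (tail_le _)) hincl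
  have hα := measurable_nodeAlpha (P := P) (x := x) hr n
  have hβ : Measurable (nodeBeta P r x n) := hα.mul_const _
  have hβdef : ∀ y, nodeBeta P r x n y
      = P (cell x n) * (tail P r (level P r x n))⁻¹ * nodeAlpha P r x n y := fun y => by
    rw [nodeBeta, div_eq_mul_inv, mul_comm]
  have hadd := nodeAlpha_add (P := P) (r := r) (x := x) n
  have hβ1 := nodeBeta_le_one (P := P) (r := r) (x := x) n
  have hwle : tail P r (level P r x n) ≤ 1 := hr1 ▸ tail_le _
  have hpt := measure_ne_top P (cell x n)
  have hsum : ∫⁻ y in cell x n, nodeAlpha P r x n y ∂P + tail P r (nextLevel P r x n)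
      = tail P r (level P r x n) := by
    rw [← hnext, ← hincl, ← lintegral_add_left hα]
    exact lintegral_congr fun y => hadd y
  have hg' : ∫⁻ y in cell x n, g y * nodeAlpha P r x n y ∂P
      + ∫⁻ y, g y * (r y - nextLevel P r x n) ∂P ≤ ∫⁻ y, g y * (r y - level P r x n) ∂P := by
    refine (add_le_add_left (setLIntegral_le_lintegral _ _) _).trans ?_
    rw [← lintegral_add_left (by fun_prop)]
    refine (lintegral_congr fun y => ?_).le
    rw [← mul_add, hadd]
  simp only [nodeCost, potential]
  set L' := nextLevel P r x n
  set w := tail P r (level P r x n)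
  set w' := tail P r L'
  set p := P (cell x n)
  set A := ∫⁻ y in cell x n, nodeAlpha P r x n y ∂P
  set I := ∫⁻ y, g y * (r y - level P r x n) ∂P
  set I' := ∫⁻ y, g y * (r y - L') ∂P
  rcases eq_or_ne w 0 with hw | hw
  · simp [hw, logPlus_top]
  have hwt : w ≠ ∞ := ne_top_of_le_ne_top ENNReal.one_ne_top hwle
  have hint : ∀ f : ℝ → ℝ≥0∞, Measurable f → p⁻¹ * ∫⁻ y in cell x n, nodeBeta P r x n y * f y ∂P
      = w⁻¹ * ∫⁻ y in cell x n, f y * nodeAlpha P r x n y ∂P := by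
    intro f hf
    simp_rw [hβdef]
    rw [← lintegral_const_mul _ (by fun_prop), ← lintegral_const_mul _ (by fun_prop)]
    refine lintegral_congr fun y => ?_
    calc p⁻¹ * (p * w⁻¹ * nodeAlpha P r x n y * f y)
        = p⁻¹ * p * (w⁻¹ * (f y * nodeAlpha P r x n y)) := by ring
      _ = w⁻¹ * (f y * nodeAlpha P r x n y) := by rw [ENNReal.inv_mul_cancel hP hpt, one_mul]
  have hacc : p⁻¹ * ∫⁻ y in cell x n, nodeBeta P r x n y ∂P = A / w := by
    have := hint (fun _ => 1) measurable_const
    simpa [div_eq_mul_inv, mul_comm] using this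
  -- the rejection probability is the ratio of the remaining masses
  have hrej : p⁻¹ * ∫⁻ y in cell x n, (1 - nodeBeta P r x n y) ∂P = w' / w := by
    have h1 : p⁻¹ * ∫⁻ y in cell x n, (1 - nodeBeta P r x n y) ∂P
        + p⁻¹ * ∫⁻ y in cell x n, nodeBeta P r x n y ∂P = 1 := by
      rw [← mul_add, ← lintegral_add_right _ hβ,
        lintegral_congr fun y => tsub_add_cancel_of_le (hβ1 y)]
      simp only [lintegral_const, MeasurableSet.univ, Measure.restrict_apply, univ_inter, one_mul]
      exact ENNReal.inv_mul_cancel hP hpt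
    have h2 : w' / w + A / w = 1 := by
      rw [← ENNReal.add_div, add_comm, hsum, ENNReal.div_self hw hwt]
    rw [hacc] at h1
    have hA : A / w ≠ ∞ := ne_top_of_le_ne_top ENNReal.one_ne_top (h2 ▸ le_add_self)
    exact (ENNReal.add_left_inj hA).1 (h1.trans h2.symm)
  rw [lintegral_add_left (by fun_prop), mul_add,
    lintegral_mul_const _ (by fun_prop), ← mul_assoc, hrej,
    hint _ (hg.add_const _)]
  simp_rw [add_mul]
  rw [lintegral_add_left (by fun_prop), lintegral_const_mul _ hα]
  set J := ∫⁻ y in cell x n, g y * nodeAlpha P r x n y ∂P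
  have hI' : w' / w * (I' / w') ≤ w⁻¹ * I' := by
    rw [div_eq_mul_inv, div_eq_mul_inv]
    calc w' * w⁻¹ * (I' * w'⁻¹) = w' * w'⁻¹ * (w⁻¹ * I') := by ring
      _ ≤ 1 * (w⁻¹ * I') := by gcongr; exact ENNReal.mul_inv_le_one _
      _ = w⁻¹ * I' := one_mul _
  calc w⁻¹ * (J + logPlus w⁻¹ * A) + w' / w * (I' / w' + (logPlus w'⁻¹ + 1))
      = w⁻¹ * J + w' / w * (I' / w')
        + (A / w * logPlus w⁻¹ + w' / w * (logPlus w'⁻¹ + 1)) := by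
        rw [div_eq_mul_inv A]; ring
    _ ≤ w⁻¹ * J + w⁻¹ * I' + (logPlus w⁻¹ + 1) := by
        exact add_le_add (add_le_add_right hI' _) (logPlus_inv_potential hsum hw hwle)
    _ ≤ I / w + (logPlus w⁻¹ + 1) := by
        rw [← mul_add, div_eq_mul_inv, mul_comm I]
        gcongr

/-! ### Measurability of the search path -/

theorem level_congr {x x' : ℕ → ℝ} (n : ℕ) (h : ∀ m < n, x m = x' m) :
    level P r x n = level P r x' n := by
  induction n using Nat.strong_induction_on with
  | _ n ih =>
    match n with
    | 0 => simp [level]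
    | 1 => simp [level]
    | n + 2 =>
      rw [level, level, ih _ (by omega) fun m hm => h m (by omega),
        cell_congr ((n + 2) / 2) fun m hm => h m (by omega)]

theorem nextLevel_congr {x x' : ℕ → ℝ} (n : ℕ) (h : ∀ m < n, x m = x' m) :
    nextLevel P r x n = nextLevel P r x' n := by
  rw [nextLevel, nextLevel, level_congr n h, cell_congr n h]

theorem nodeBeta_congr {x x' : ℕ → ℝ} (n : ℕ) (h : ∀ m < n, x m = x' m) :
    nodeBeta P r x n = nodeBeta P r x' n := by
  funext y
  rw [nodeBeta, nodeBeta, nodeAlpha, nodeAlpha, level_congr n h, cell_congr n h]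

theorem reached_congr {x x' u u' : ℕ → ℝ} (n : ℕ) (h : ∀ m < n, x m = x' m)
    (hu : ∀ m < n, u m = u' m) : Reached P r x u n ↔ Reached P r x' u' n := by
  induction n using Nat.strong_induction_on with
  | _ n ih =>
    match n with
    | 0 => simp [Reached]
    | 1 => simp [Reached]
    | n + 2 =>
      have hx2 : ∀ m < (n + 2) / 2, x m = x' m := fun m hm => h m (by omega)
      rw [Reached, Reached, ih _ (by omega) hx2 fun m hm => hu m (by omega),
        nodeBeta_congr _ hx2, h ((n + 2) / 2) (by omega), hu ((n + 2) / 2) (by omega),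
        nextLevel_congr _ hx2, cell_congr (n + 2) h]
      rw [cell_right x (show 1 ≤ (n + 2) / 2 by omega),
        cell_right x' (show 1 ≤ (n + 2) / 2 by omega), cell_congr _ hx2,
        h ((n + 2) / 2) (by omega)]

theorem measurable_tail : Measurable (tail P r) := tail_antitone.measurable

theorem measurable_potential : Measurable (potential P r g) := by
  have h : Measurable fun h => ∫⁻ y, g y * (r y - h) ∂P :=
    Antitone.measurable fun _ _ h => lintegral_mono fun _ => by gcongr
  exact (h.div measurable_tail).add
    ((measurable_logPlus.comp measurable_tail.inv).add measurable_const)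

theorem measurable_level [SFinite P] (n : ℕ) : Measurable fun x => level P r x n := by
  induction n using Nat.strong_induction_on with
  | _ n ih =>
    match n with
    | 0 => simp [level]
    | 1 => simp [level]
    | n + 2 =>
      simp only [level]
      exact (ih _ (by omega)).add ((measurable_tail.comp (ih _ (by omega))).div
        (measurable_measure_cell P measurable_id measurable_const))

theorem measurable_nextLevel [SFinite P] (n : ℕ) : Measurable fun x => nextLevel P r x n :=
  (measurable_level n).add ((measurable_tail.comp (measurable_level n)).div
    (measurable_measure_cell P measurable_id measurable_const))

theorem measurable_nodeBeta [SFinite P] (hr : Measurable r) (n : ℕ) :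
    Measurable fun p : (ℕ → ℝ) × ℝ => nodeBeta P r p.1 n p.2 := by
  have hl : Measurable fun p : (ℕ → ℝ) × ℝ => level P r p.1 n :=
    (measurable_level n).comp measurable_fst
  have hc : Measurable fun p : (ℕ → ℝ) × ℝ => P (cell p.1 n) :=
    measurable_measure_cell P measurable_fst measurable_const
  have hw := (measurable_tail (P := P) (r := r)).comp hl
  exact (((hr.comp measurable_snd).sub hl).min (hw.div hc)).mul (hc.div hw)

theorem measurable_nodeCost [SFinite P] (hg : Measurable g) (n : ℕ) :
    Measurable fun p : (ℕ → ℝ) × ℝ => nodeCost P r g p.1 n p.2 :=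
  (hg.comp measurable_snd).add (measurable_logPlus.comp
    (measurable_tail.comp ((measurable_level n).comp measurable_fst)).inv)

theorem measurableSet_reached [SFinite P] (hr : Measurable r) (n : ℕ) :
    MeasurableSet {p : (ℕ → ℝ) × (ℕ → ℝ) | Reached P r p.1 p.2 n} := by
  induction n using Nat.strong_induction_on with
  | _ n ih =>
    match n with
    | 0 => simp [Reached]
    | 1 => simp [Reached]
    | n + 2 =>
      have hN : Measurable fun p : (ℕ → ℝ) × (ℕ → ℝ) => nextLevel P r p.1 ((n + 2) / 2) :=
        (measurable_nextLevel _).comp measurable_fst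
      have hI : ∀ k, Measurable fun p : (ℕ → ℝ) × (ℕ → ℝ) =>
          ∫⁻ y in cell p.1 k, (r y - nextLevel P r p.1 ((n + 2) / 2)) ∂P := fun k =>
        measurable_setLIntegral_cell P measurable_fst measurable_const
          ((hr.comp measurable_snd).sub (hN.comp measurable_fst))
      have hx : Measurable fun p : (ℕ → ℝ) × (ℕ → ℝ) => (p.1, p.1 ((n + 2) / 2)) := by fun_prop
      have hb : Measurable fun p : (ℕ → ℝ) × (ℕ → ℝ) =>
          nodeBeta P r p.1 ((n + 2) / 2) (p.1 ((n + 2) / 2)) := (measurable_nodeBeta hr _).comp hx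
      have hu : Measurable fun p : (ℕ → ℝ) × (ℕ → ℝ) => ENNReal.ofReal (p.2 ((n + 2) / 2)) := by
        fun_prop
      have h1 := measurableSet_lt hb hu
      have h2 := measurableSet_eq_fun (hI (2 * ((n + 2) / 2) + 1)) measurable_const (g := fun _ => 0)
      have h3 := measurableSet_eq_fun (hI (n + 2)) ((measurable_tail (P := P) (r := r)).comp hN)
      simp only [Reached]
      refine (ih _ (by omega)).inter (h1.inter (MeasurableSet.inter ?_ h3))
      by_cases he : Even n
      · simp only [he, true_iff]
        exact h2
      · simp only [he, false_iff]
        exact h2.compl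

/-! ### Termination and the cost of the accepted node -/

open scoped Classical in
theorem setLIntegral_ite_le {β : ℝ≥0∞} (hβ : β ≤ 1) (c e : ℝ≥0∞) :
    ∫⁻ b in Icc (0 : ℝ) 1, (if ENNReal.ofReal b ≤ β then c else e) = β * c + (1 - β) * e := by
  have hβt : β ≠ ∞ := ne_top_of_le_ne_top ENNReal.one_ne_top hβ
  have hs : MeasurableSet {b : ℝ | ENNReal.ofReal b ≤ β} :=
    measurableSet_le ENNReal.measurable_ofReal measurable_const
  have hvol : volume.restrict (Icc (0 : ℝ) 1) {b : ℝ | ENNReal.ofReal b ≤ β} = β := by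
    have : {b : ℝ | ENNReal.ofReal b ≤ β} ∩ Icc 0 1 = Icc 0 β.toReal := by
      ext b
      simp only [mem_inter_iff, mem_ofPred_eq, mem_Icc]
      rw [ENNReal.ofReal_le_iff_le_toReal hβt]
      have h1 : β.toReal ≤ 1 := ENNReal.toReal_le_of_le_ofReal zero_le_one (by simpa using hβ)
      exact ⟨fun h => ⟨h.2.1, h.1⟩, fun h => ⟨h.2, h.1, h.2.trans h1⟩⟩
    rw [Measure.restrict_apply hs, this, Real.volume_Icc, sub_zero, ENNReal.ofReal_toReal hβt]
  have hvolc : volume.restrict (Icc (0 : ℝ) 1) {b : ℝ | ENNReal.ofReal b ≤ β}ᶜ = 1 - β := by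
    rw [measure_compl hs (by rw [hvol]; exact hβt), hvol]
    simp
  rw [← lintegral_add_compl _ hs, setLIntegral_congr_fun (g := fun _ => c) hs,
    setLIntegral_congr_fun (g := fun _ => e) hs.compl, lintegral_const, lintegral_const,
    Measure.restrict_apply_univ, Measure.restrict_apply_univ, hvol, hvolc, mul_comm c, mul_comm e]
  · intro b hb; exact if_neg hb
  · intro b hb; exact if_pos hb

/-- The event that the search path arrives at the node `n`. -/
def reachedSet (P : Measure ℝ) (r : ℝ → ℝ≥0∞) (n : ℕ) : Set ((ℕ → ℝ) × (ℕ → ℝ)) :=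
  {p | Reached P r p.1 p.2 n}

/-- The event that the sampler halts at the node `n`. -/
def acceptedSet (P : Measure ℝ) (r : ℝ → ℝ≥0∞) (n : ℕ) : Set ((ℕ → ℝ) × (ℕ → ℝ)) :=
  reachedSet P r n ∩ {p | ENNReal.ofReal (p.2 n) ≤ nodeBeta P r p.1 n (p.1 n)}

section Source

variable {Ω : Type*} [MeasurableSpace Ω] {μ : Measure Ω} [IsProbabilityMeasure μ] {P : Measure ℝ}
  [IsProbabilityMeasure P] {X U V : ℕ → Ω → ℝ} {r g : ℝ → ℝ≥0∞}

theorem measurableSet_acceptedSet (hr : Measurable r) (n : ℕ) :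
    MeasurableSet (acceptedSet P r n) := by
  refine (measurableSet_reached hr n).inter (measurableSet_le ?_ ?_)
  · fun_prop
  · exact (measurable_nodeBeta hr n).comp
      (by fun_prop : Measurable fun p : (ℕ → ℝ) × (ℕ → ℝ) => (p.1, p.1 n))

theorem measurable_reachedSet_indicator (hr : Measurable r) (n : ℕ) :
    Measurable ((reachedSet P r n).indicator fun p => potential P r g (level P r p.1 n)) :=
  (measurable_potential.comp ((measurable_level n).comp measurable_fst)).indicator
    (measurableSet_reached hr n)

theorem measurable_acceptedSet_indicator (hr : Measurable r) (hg : Measurable g) (n : ℕ) :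
    Measurable ((acceptedSet P r n).indicator fun p => nodeCost P r g p.1 n (p.1 n)) :=
  ((measurable_nodeCost hg n).comp
    (by fun_prop : Measurable fun p : (ℕ → ℝ) × (ℕ → ℝ) => (p.1, p.1 n))).indicator
    (measurableSet_acceptedSet hr n)

omit [IsProbabilityMeasure P] in
open scoped Classical in
/-- Acceptance at a node and the potentials of its children, in terms of a single trial. -/
theorem indicator_add_indicator_children_le {n : ℕ} (hn : 1 ≤ n) (p : (ℕ → ℝ) × (ℕ → ℝ)) :
    (acceptedSet P r n).indicator (fun p => nodeCost P r g p.1 n (p.1 n)) p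
      + ((reachedSet P r (2 * n)).indicator (fun p => potential P r g (level P r p.1 (2 * n))) p
        + (reachedSet P r (2 * n + 1)).indicator
          (fun p => potential P r g (level P r p.1 (2 * n + 1))) p)
    ≤ if Reached P r p.1 p.2 n then
        (if ENNReal.ofReal (p.2 n) ≤ nodeBeta P r p.1 n (p.1 n) then nodeCost P r g p.1 n (p.1 n)
          else potential P r g (nextLevel P r p.1 n)) else 0 := by
  have h1 : p ∈ reachedSet P r (2 * n) → Reached P r p.1 p.2 n ∧
      ¬ ENNReal.ofReal (p.2 n) ≤ nodeBeta P r p.1 n (p.1 n) := by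
    intro h
    have := (reached_of_two_le (by omega)).1 h
    rw [show 2 * n / 2 = n by omega] at this
    exact ⟨this.1, not_le.2 this.2.1⟩
  have h2 : p ∈ reachedSet P r (2 * n + 1) → Reached P r p.1 p.2 n ∧
      ¬ ENNReal.ofReal (p.2 n) ≤ nodeBeta P r p.1 n (p.1 n) := by
    intro h
    have := (reached_of_two_le (by omega)).1 h
    rw [show (2 * n + 1) / 2 = n by omega] at this
    exact ⟨this.1, not_le.2 this.2.1⟩
  by_cases hL : p ∈ reachedSet P r (2 * n)
  · have hR : p ∉ reachedSet P r (2 * n + 1) := fun hR => not_reached_left_and_right hn hL hR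
    rw [indicator_of_notMem (fun h => (h1 hL).2 h.2), indicator_of_mem hL, indicator_of_notMem hR,
      if_pos (h1 hL).1, if_neg (h1 hL).2, level_left hn]
    simp
  by_cases hR : p ∈ reachedSet P r (2 * n + 1)
  · rw [indicator_of_notMem (fun h => (h2 hR).2 h.2), indicator_of_notMem hL, indicator_of_mem hR,
      if_pos (h2 hR).1, if_neg (h2 hR).2, level_right hn]
    simp
  rw [indicator_of_notMem hL, indicator_of_notMem hR, add_zero, add_zero]
  by_cases hA : p ∈ acceptedSet P r n
  · have hA2 : ENNReal.ofReal (p.2 n) ≤ nodeBeta P r p.1 n (p.1 n) := hA.2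
    rw [indicator_of_mem hA, if_pos (show Reached P r p.1 p.2 n from hA.1), if_pos hA2]
  · rw [indicator_of_notMem hA]
    exact zero_le

open scoped Classical in
/-- The inequality of `potential_step` in expectation: the expected potential of a node, if reached,
pays for its expected cost, if accepted, and for the expected potentials of its children. -/
theorem IsSampleSplittingSource.lintegral_step_le [NullSingletonClass P]
    (h : IsSampleSplittingSource μ P X U V) (hr : Measurable r) (hg : Measurable g)
    (hr1 : ∫⁻ y, r y ∂P = 1) {n : ℕ} (hn : 1 ≤ n) :
    ∫⁻ ω, (acceptedSet P r n).indicator (fun p => nodeCost P r g p.1 n (p.1 n))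
        ((fun k => X k ω), (fun k => U k ω)) ∂μ
      + (∫⁻ ω, (reachedSet P r (2 * n)).indicator
          (fun p => potential P r g (level P r p.1 (2 * n)))
          ((fun k => X k ω), (fun k => U k ω)) ∂μ
        + ∫⁻ ω, (reachedSet P r (2 * n + 1)).indicator
          (fun p => potential P r g (level P r p.1 (2 * n + 1)))
          ((fun k => X k ω), (fun k => U k ω)) ∂μ)
    ≤ ∫⁻ ω, (reachedSet P r n).indicator (fun p => potential P r g (level P r p.1 n))
        ((fun k => X k ω), (fun k => U k ω)) ∂μ := by
  have hmA : Measurable fun ω => (acceptedSet P r n).indicator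
      (fun p => nodeCost P r g p.1 n (p.1 n)) ((fun k => X k ω), (fun k => U k ω)) :=
    (measurable_acceptedSet_indicator hr hg n).comp h.measurable_path
  have hmR : ∀ m, Measurable fun ω => (reachedSet P r m).indicator
      (fun p => potential P r g (level P r p.1 m)) ((fun k => X k ω), (fun k => U k ω)) :=
    fun m => (measurable_reachedSet_indicator hr m).comp h.measurable_path
  rw [← lintegral_add_left (hmR (2 * n)), ← lintegral_add_left hmA]
  refine (lintegral_mono fun ω => indicator_add_indicator_children_le hn _).trans ?_
  set F : (ℕ → ℝ) → (ℕ → ℝ) → ℝ → ℝ → ℝ≥0∞ := fun x u a b =>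
    if Reached P r x u n then
      (if ENNReal.ofReal b ≤ nodeBeta P r x n a then nodeCost P r g x n a
        else potential P r g (nextLevel P r x n)) else 0 with hFdef
  have hxa : Measurable fun p : ((ℕ → ℝ) × (ℕ → ℝ)) × ℝ × ℝ => (p.1.1, p.2.1) := by fun_prop
  have hF : Measurable fun p : ((ℕ → ℝ) × (ℕ → ℝ)) × ℝ × ℝ => F p.1.1 p.1.2 p.2.1 p.2.2 := by
    refine Measurable.ite (measurable_fst (measurableSet_reached hr n)) ?_ measurable_const
    refine Measurable.ite (measurableSet_le (by fun_prop) ((measurable_nodeBeta hr n).comp hxa))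
      ((measurable_nodeCost hg n).comp hxa) ?_
    exact measurable_potential.comp
      ((measurable_nextLevel n).comp (measurable_fst.comp measurable_fst))
  have hdep : ∀ x x' u u', (∀ m < n, x m = x' m) → (∀ m < n, u m = u' m) → F x u = F x' u' := by
    intro x x' u u' hx hu
    funext a b
    simp only [hFdef, nodeCost]
    rw [if_congr (reached_congr n hx hu) rfl rfl, nodeBeta_congr n hx, level_congr n hx,
      nextLevel_congr n hx]
  refine (h.lintegral_node hn hF hdep).le.trans (lintegral_mono_ae ?_)
  filter_upwards [h.ae_measure_cell_ne_zero] with ω hω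
  by_cases hre : Reached P r (fun k => X k ω) (fun k => U k ω) n
  · rw [indicator_of_mem (show ((fun k => X k ω), (fun k => U k ω)) ∈ reachedSet P r n from hre)]
    refine le_trans (le_of_eq ?_) (potential_step hr hg hr1 (hω n hn) hre.setLIntegral_eq)
    rw [lintegral_lintegral_swap, lintegral_cond]
    · congr 1
      refine lintegral_congr fun a => ?_
      simp only [hFdef, if_pos hre]
      exact setLIntegral_ite_le (nodeBeta_le_one _ _) _ _
    · exact (hF.comp (by fun_prop : Measurable fun q : ℝ × ℝ =>
        (((fun k => X k ω), (fun k => U k ω)), (q.2, q.1)))).aemeasurable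
  · simp [hFdef, hre]

omit [IsProbabilityMeasure P] in
theorem potential_zero (hr1 : ∫⁻ y, r y ∂P = 1) :
    potential P r g 0 = ∫⁻ y, g y * r y ∂P + 1 := by
  simp [potential, tail_zero, hr1, logPlus_one]

omit [IsProbabilityMeasure P] in
theorem lintegral_reachedSet_one (hr1 : ∫⁻ y, r y ∂P = 1) :
    ∫⁻ ω, (reachedSet P r 1).indicator (fun p => potential P r g (level P r p.1 1))
        ((fun k => X k ω), (fun k => U k ω)) ∂μ = ∫⁻ y, g y * r y ∂P + 1 := by
  rw [← potential_zero hr1, lintegral_congr (g := fun _ => potential P r g 0)]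
  · simp
  · intro ω
    rw [indicator_of_mem (show _ ∈ reachedSet P r 1 from reached_one), level_one]

variable {Q : Measure ℝ}

/-- The sampler halts almost surely: `ln (1 / w)`, with `w` the remaining mass, would tend to
infinity along an infinite search path, but its expectation on the event of surviving the first `d`
steps is at most `1`. -/
theorem IsSampleSplittingSource.ae_terminates [NullSingletonClass P]
    (h : IsSampleSplittingSource μ P X U V) (hr : Measurable r) (hQ : Q = P.withDensity r)
    (hr1 : ∫⁻ y, r y ∂P = 1) (hu : IsUnimodal r) :
    ∀ᵐ ω ∂μ, Terminates P Q r (fun k => X k ω) (fun k => U k ω) (fun k => V k ω) := by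
  let f : ℕ → Ω → ℝ≥0∞ := fun d ω => ∑ n ∈ Finset.Ico (2 ^ d) (2 ^ (d + 1)),
    (reachedSet P r n).indicator (fun p => potential P r (fun _ => 0) (level P r p.1 n))
      ((fun k => X k ω), (fun k => U k ω))
  have hmR : ∀ m, Measurable fun ω => (reachedSet P r m).indicator
      (fun p => potential P r (fun _ => 0) (level P r p.1 m))
      ((fun k => X k ω), (fun k => U k ω)) :=
    fun m => (measurable_reachedSet_indicator hr m).comp h.measurable_path
  have hfm : ∀ d, Measurable (f d) := fun d => Finset.measurable_sum _ fun n _ => hmR n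
  have hf1 : ∀ d, ∫⁻ ω, f d ω ∂μ ≤ 1 := by
    intro d
    rw [show ∫⁻ ω, f d ω ∂μ = _ from lintegral_finsetSum _ fun n _ => hmR n]
    refine (sum_depth_le_of_potential (fun n hn =>
      h.lintegral_step_le hr measurable_const hr1 hn) d).trans ?_
    rw [lintegral_reachedSet_one hr1]
    simp
  have hlim : ∫⁻ ω, Filter.liminf (fun d => f d ω) Filter.atTop ∂μ ≤ 1 :=
    (lintegral_liminf_le hfm).trans
      (Filter.liminf_le_of_frequently_le' (Filter.Frequently.of_forall hf1))
  have hfin := ae_lt_top (.liminf hfm) (ne_top_of_le_ne_top ENNReal.one_ne_top hlim)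
  filter_upwards [hfin, h.ae_regular] with ω hω hreg
  by_contra hterm
  refine hω.ne (ENNReal.eq_top_of_forall_nnreal_le fun M => ?_)
  simp only [Terminates, not_exists] at hterm
  have hinv := fun d => state_invariant hr hQ hr1 hu hreg d fun k _ => hterm k
  set I : ℕ → ℕ := fun d =>
    (state P Q r (fun k => X k ω) (fun k => V k ω) d).index with hI
  have hI1 : ∀ d, 1 ≤ I d := fun d => Nat.one_le_two_pow.trans (hinv d).1
  have hsucc : ∀ d, level P r (fun k => X k ω) (I (d + 1)) = nextLevel P r (fun k => X k ω) (I d) :=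
    by
    intro d
    have : I (d + 1) = 2 * I d ∨ I (d + 1) = 2 * I d + 1 := by
      simp only [hI, state, State.next, State.nextIndex]
      split_ifs
      · exact .inr rfl
      · exact .inl rfl
    rcases this with h | h
    · rw [h, level_left (hI1 d)]
    · rw [h, level_right (hI1 d)]
  have hstep : ∀ d, level P r (fun k => X k ω) (I d) + tail P r (level P r (fun k => X k ω) (I d))
      ≤ level P r (fun k => X k ω) (I (d + 1)) := by
    intro d
    rw [hsucc, nextLevel]
    gcongr
    rw [ENNReal.le_div_iff_mul_le (.inl (hreg.measure_cell_ne_zero _ (hI1 d)))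
      (.inl (measure_ne_top _ _))]
    exact mul_le_of_le_one_right' prob_le_one
  obtain ⟨D, hD⟩ := exists_tail_lt_of_add_le hr (hr1 ▸ ENNReal.one_ne_top) hstep
    (ε := ENNReal.ofReal (Real.exp (-M))) (by simp [Real.exp_pos])
  refine Filter.le_liminf_of_le (by isBoundedDefault) ?_
  filter_upwards [Filter.eventually_ge_atTop D] with d hd
  have hmem : I d ∈ Finset.Ico (2 ^ d) (2 ^ (d + 1)) :=
    Finset.mem_Ico.2 ⟨(hinv d).1, (hinv d).2.1⟩
  refine le_trans ?_ (Finset.single_le_sum (fun _ _ => zero_le) hmem)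
  rw [indicator_of_mem (show _ ∈ reachedSet P r (I d) from (hinv d).2.2.1)]
  calc (M : ℝ≥0∞) = logPlus (ENNReal.ofReal (Real.exp (-M)))⁻¹ := by
        rw [logPlus_inv (by simp [Real.exp_pos]), ENNReal.toReal_ofReal (Real.exp_nonneg _),
          Real.log_exp, neg_neg, ENNReal.ofReal_coe_nnreal]
    _ ≤ logPlus (tail P r (level P r (fun k => X k ω) (I d)))⁻¹ :=
        logPlus_mono (ENNReal.inv_le_inv.2 (hD d hd).le)
    _ ≤ potential P r (fun _ => 0) (level P r (fun k => X k ω) (I d)) :=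
        le_self_add.trans le_add_self

end Source

/-- The heap index of the node at which the sampler halts. -/
noncomputable def returnedIndex (P Q : Measure ℝ) (r : ℝ → ℝ≥0∞) (x u v : ℕ → ℝ) : ℕ :=
  (state P Q r x v (stopTime P Q r x u v)).index

/-- `ln (1 / P (Z_m))` for the parent `m` of the node `n`, and `0` for the root. -/
noncomputable def parentCost (P : Measure ℝ) (x : ℕ → ℝ) (n : ℕ) : ℝ≥0∞ :=
  if n = 1 then 0 else logPlus (P (cell x (n / 2)))⁻¹

section Cost

variable {P Q : Measure ℝ} [IsProbabilityMeasure P] {r : ℝ → ℝ≥0∞} {x u v : ℕ → ℝ}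

theorem returnedIndex_spec (hr : Measurable r) (hQ : Q = P.withDensity r)
    (hr1 : ∫⁻ y, r y ∂P = 1) (hu : IsUnimodal r) (hreg : Regular P x u v)
    (hterm : Terminates P Q r x u v) : 1 ≤ returnedIndex P Q r x u v ∧
      (x, u) ∈ acceptedSet P r (returnedIndex P Q r x u v) := by
  have hacc : Accepts P Q r x u v (stopTime P Q r x u v) := Nat.sInf_mem hterm
  have hrej : ∀ k < stopTime P Q r x u v, ¬ Accepts P Q r x u v k := fun k hk =>
    Nat.notMem_of_lt_sInf hk
  have hinv := state_invariant hr hQ hr1 hu hreg _ hrej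
  exact ⟨Nat.one_le_two_pow.trans hinv.1, hinv.2.2.1,
    (accepts_iff hr hQ hr1 hu hreg _ hrej).1 hacc⟩

omit [IsProbabilityMeasure P] in
/-- At the accepting node `n`, with parent `m`, `r (X_n)` exceeds the level of `n`, which is at least
`w / P (Z_m)`, where `w` is the mass that remains at `n`. -/
theorem parentCost_le (hreg : Regular P x u v) {n : ℕ} (hn : 1 ≤ n)
    (hacc : (x, u) ∈ acceptedSet P r n) :
    parentCost P x n ≤ nodeCost P r (fun y => logPlus (r y)) x n (x n) := by
  rw [parentCost]
  split_ifs with h1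
  · exact zero_le
  rw [nodeCost]
  rcases eq_or_ne (tail P r (level P r x n)) 0 with hw | hw
  · simp [hw, logPlus_top]
  refine (logPlus_mono ?_).trans (logPlus_mul_le _ _)
  have hpos : 0 < nodeBeta P r x n (x n) :=
    (ENNReal.ofReal_pos.2 (hreg.u_pos n)).trans_le hacc.2
  have hlt : level P r x n ≤ r (x n) := by
    by_contra! hlt
    rw [nodeBeta, nodeAlpha, tsub_eq_zero_of_le hlt.le] at hpos
    simp at hpos
  refine le_trans ?_ (mul_le_mul_left hlt _)
  have hlev : tail P r (level P r x n) / P (cell x (n / 2)) ≤ level P r x n := by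
    conv_rhs => rw [level_of_two_le (show 2 ≤ n by omega), nextLevel]
    refine le_trans ?_ le_add_self
    gcongr
    refine tail_antitone ?_
    rw [level_of_two_le (show 2 ≤ n by omega)]
    exact le_nextLevel _
  refine le_trans ?_ (mul_le_mul_left hlev _)
  rcases eq_or_ne (tail P r (level P r x n)) ∞ with hwt | hwt
  · exfalso
    simp [nodeBeta, hwt, ENNReal.div_top] at hpos
  · rw [div_eq_mul_inv, mul_comm, ← mul_assoc, ENNReal.inv_mul_cancel hw hwt, one_mul]

theorem lintegral_logPlus_mul_le (hr : Measurable r) (hr1 : ∫⁻ y, r y ∂P = 1)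
    [IsFiniteMeasure Q] (hQ : Q = P.withDensity r) :
    ∫⁻ y, logPlus (r y) * r y ∂P ≤ InformationTheory.klDiv Q P + 1 := by
  have hac : Q ≪ P := hQ ▸ withDensity_absolutelyContinuous _ _
  have hrn : Q.rnDeriv P =ᵐ[P] r := hQ ▸ Measure.rnDeriv_withDensity P hr
  rw [InformationTheory.klDiv_eq_lintegral_klFun, if_pos hac, ← hr1, ← lintegral_add_right _ hr]
  refine lintegral_mono_ae ?_
  filter_upwards [hrn, ae_lt_top hr (hr1 ▸ ENNReal.one_ne_top)] with y hy hlt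
  rw [hy]
  exact logPlus_mul_self_le hlt.ne

variable {Ω : Type*} [MeasurableSpace Ω] {μ : Measure Ω} [IsProbabilityMeasure μ]
  {X U V : ℕ → Ω → ℝ}

/-- On average, the parent of the returned node has a cell of probability about `exp (-D)`, with
`D` the relative entropy of the target in nats. -/
theorem IsSampleSplittingSource.lintegral_parentCost_le [NullSingletonClass P] [IsFiniteMeasure Q]
    (h : IsSampleSplittingSource μ P X U V) (hr : Measurable r) (hQ : Q = P.withDensity r)
    (hr1 : ∫⁻ y, r y ∂P = 1) (hu : IsUnimodal r) :
    ∫⁻ ω, parentCost P (fun k => X k ω) (returnedIndex P Q r (fun k => X k ω) (fun k => U k ω)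
      (fun k => V k ω)) ∂μ ≤ InformationTheory.klDiv Q P + 2 := by
  have hg : Measurable fun y => logPlus (r y) := measurable_logPlus.comp hr
  have hle : ∀ᵐ ω ∂μ, parentCost P (fun k => X k ω) (returnedIndex P Q r (fun k => X k ω)
      (fun k => U k ω) (fun k => V k ω)) ≤ ∑' n, (acceptedSet P r (n + 1)).indicator
        (fun p => nodeCost P r (fun y => logPlus (r y)) p.1 (n + 1) (p.1 (n + 1)))
        ((fun k => X k ω), (fun k => U k ω)) := by
    filter_upwards [h.ae_regular, h.ae_terminates hr hQ hr1 hu] with ω hreg hterm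
    obtain ⟨h1, hacc⟩ := returnedIndex_spec hr hQ hr1 hu hreg hterm
    obtain ⟨n, hn⟩ : ∃ n, returnedIndex P Q r (fun k => X k ω) (fun k => U k ω)
      (fun k => V k ω) = n + 1 := ⟨_, (Nat.sub_add_cancel h1).symm⟩
    rw [hn] at hacc ⊢
    refine le_trans ?_ (ENNReal.le_tsum n)
    rw [indicator_of_mem hacc]
    exact parentCost_le hreg (by omega) hacc
  have hmA : ∀ n, AEMeasurable (fun ω => (acceptedSet P r (n + 1)).indicator
      (fun p => nodeCost P r (fun y => logPlus (r y)) p.1 (n + 1) (p.1 (n + 1)))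
      ((fun k => X k ω), (fun k => U k ω))) μ := fun n =>
    ((measurable_acceptedSet_indicator hr hg (n + 1)).comp h.measurable_path).aemeasurable
  refine (lintegral_mono_ae hle).trans ?_
  rw [lintegral_tsum hmA]
  refine (tsum_le_of_potential fun n hn => h.lintegral_step_le hr hg hr1 hn).trans ?_
  rw [lintegral_reachedSet_one hr1, show (2 : ℝ≥0∞) = 1 + 1 by norm_num, ← add_assoc]
  gcongr
  exact lintegral_logPlus_mul_le hr hr1 hQ

end Cost

/-! ### Measurability of the sampler -/

section Measurability

variable {β : Type*} [MeasurableSpace β] {P : Measure ℝ} [SFinite P] {r : β → ℝ → ℝ≥0∞}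
  {x u v : β → ℕ → ℝ}

theorem measurable_apply_nat {x : β → ℕ → ℝ} (hx : Measurable x) {n : β → ℕ} (hn : Measurable n) :
    Measurable fun b => x b (n b) := by
  have h : Measurable fun p : (ℕ → ℝ) × ℕ => p.1 p.2 :=
    measurable_from_prod_countable_left fun n => measurable_pi_apply n
  exact h.comp (hx.prodMk hn)

/-- The state of the sampler depends measurably on the density ratio and on the randomness. -/
theorem measurable_state (hr : Measurable (Function.uncurry r)) (hx : Measurable x)
    (hv : Measurable v) (d : ℕ) :
    (Measurable fun b => (state P (P.withDensity (r b)) (r b) (x b) (v b) d).index) ∧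
      (Measurable fun p : β × ℝ =>
        (state P (P.withDensity (r p.1)) (r p.1) (x p.1) (v p.1) d).density p.2) ∧
      (Measurable fun b => (state P (P.withDensity (r b)) (r b) (x b) (v b) d).mass univ) ∧
      (Measurable fun p : β × ℝ =>
        (state P (P.withDensity (r p.1)) (r p.1) (x p.1) (v p.1) d).alpha P (r p.1) (x p.1) p.2)
      := by
  set s : β → ℕ → State := fun b d => state P (P.withDensity (r b)) (r b) (x b) (v b) d with hs
  have hrb : ∀ b, Measurable (r b) := fun b => hr.comp measurable_prodMk_left
  have hmass : ∀ b d, (s b d).mass = P.withDensity (s b d).density := fun b d =>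
    (state_mass_eq_withDensity P (P.withDensity (r b)) (r b) (x b) (v b) (hrb b) rfl d).2
  -- the last two claims follow from the first two
  have hrest : ∀ d, (Measurable fun b => (s b d).index) →
      (Measurable fun p : β × ℝ => (s p.1 d).density p.2) →
      (Measurable fun b => (s b d).mass univ) ∧
      (Measurable fun p : β × ℝ => (s p.1 d).alpha P (r p.1) (x p.1) p.2) := by
    intro d hi hd
    have hm : Measurable fun b => (s b d).mass univ := by
      simp_rw [hmass, withDensity_apply _ MeasurableSet.univ, Measure.restrict_univ]
      exact hd.lintegral_prod_right'
    refine ⟨hm, ?_⟩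
    have hP := measurable_measure_cell P hx hi
    exact (hr.sub hd).min (((measurable_const.sub hm).div hP).comp measurable_fst)
  induction d with
  | zero =>
    have h1 : Measurable fun b => (s b 0).index := measurable_const
    have h2 : Measurable fun p : β × ℝ => (s p.1 0).density p.2 := measurable_const
    exact ⟨h1, h2, hrest 0 h1 h2⟩
  | succ d ih =>
    obtain ⟨hi, hd, hm, ha⟩ := ih
    have hint : ∀ n : β → ℕ, Measurable n → Measurable fun b =>
        P.withDensity (r b) (cell (x b) (n b)) - (s b d).mass (cell (x b) (n b))
          - (s b d).accMass P (r b) (x b) (cell (x b) (n b)) := by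
      intro n hn
      simp_rw [hmass, State.accMass, withDensity_apply _ (measurableSet_cell _ _)]
      exact ((measurable_setLIntegral_cell P hx hn hr).sub
        (measurable_setLIntegral_cell P hx hn (f := fun b => (s b d).density) hd)).sub
          (measurable_setLIntegral_cell P hx hn (f := fun b => (s b d).alpha P (r b) (x b)) ha)
    have hR : Measurable fun b => 2 * (s b d).index + 1 := by fun_prop
    have hprob : Measurable fun b =>
        (s b d).rightProb P (P.withDensity (r b)) (r b) (x b) :=
      (hint _ hR).div (hint _ hi)
    have hi' : Measurable fun b => (s b (d + 1)).index := by
      refine (hi.const_mul 2).add (Measurable.ite (measurableSet_le ?_ hprob) measurable_const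
        measurable_const)
      exact ENNReal.measurable_ofReal.comp (measurable_apply_nat hv hi)
    have hset := measurableSet_mem_cell_comp hx hi'
    have hd' : Measurable fun p : β × ℝ => (s p.1 (d + 1)).density p.2 :=
      ((hd.add ha).indicator hset).add (hr.indicator hset.compl)
    exact ⟨hi', hd', hrest (d + 1) hi' hd'⟩

theorem measurableSet_accepts (hr : Measurable (Function.uncurry r)) (hx : Measurable x)
    (hu : Measurable u) (hv : Measurable v) (d : ℕ) :
    MeasurableSet {b | Accepts P (P.withDensity (r b)) (r b) (x b) (u b) (v b) d} := by
  obtain ⟨hi, hd, hm, ha⟩ := measurable_state (P := P) hr hx hv d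
  refine measurableSet_le (ENNReal.measurable_ofReal.comp (measurable_apply_nat hu hi)) ?_
  refine Measurable.mul ?_ ((measurable_measure_cell P hx hi).div (measurable_const.sub hm))
  exact ha.comp (measurable_id.prodMk (measurable_apply_nat hx hi))

theorem measurableSet_terminates (hr : Measurable (Function.uncurry r)) (hx : Measurable x)
    (hu : Measurable u) (hv : Measurable v) :
    MeasurableSet {b | Terminates P (P.withDensity (r b)) (r b) (x b) (u b) (v b)} := by
  have : {b | Terminates P (P.withDensity (r b)) (r b) (x b) (u b) (v b)}
      = ⋃ d, {b | Accepts P (P.withDensity (r b)) (r b) (x b) (u b) (v b) d} := by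
    ext b; simp [Terminates]
  rw [this]
  exact MeasurableSet.iUnion fun d => measurableSet_accepts hr hx hu hv d

theorem measurable_sInf_nat {A : ℕ → Set β} (hA : ∀ d, MeasurableSet (A d)) :
    Measurable fun b => sInf {d | b ∈ A d} := by
  refine measurable_to_countable' fun n => ?_
  have : (fun b => sInf {d | b ∈ A d}) ⁻¹' {n}
      = (A n ∩ ⋂ k, ⋂ (_ : k < n), (A k)ᶜ) ∪ ({_b | n = 0} ∩ ⋂ k, (A k)ᶜ) := by
    ext b
    simp only [mem_preimage, mem_singleton_iff, mem_union, mem_inter_iff, mem_iInter, mem_compl_iff,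
      mem_ofPred_eq]
    constructor
    · rintro rfl
      by_cases hne : {d | b ∈ A d}.Nonempty
      · exact .inl ⟨Nat.sInf_mem hne, fun k hk => Nat.notMem_of_lt_sInf hk⟩
      · refine .inr ⟨?_, fun k hk => hne ⟨k, hk⟩⟩
        rw [not_nonempty_iff_eq_empty.1 hne, Nat.sInf_empty]
    · rintro (⟨h1, h2⟩ | ⟨rfl, h⟩)
      · refine le_antisymm (Nat.sInf_le h1) (le_csInf ⟨n, h1⟩ fun k hk => ?_)
        exact not_lt.1 fun hlt => h2 k hlt hk
      · rw [show {d | b ∈ A d} = ∅ from eq_empty_of_forall_notMem h, Nat.sInf_empty]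
  rw [this]
  refine ((hA n).inter (MeasurableSet.iInter fun k => MeasurableSet.iInter fun _ =>
    (hA k).compl)).union (MeasurableSet.inter (MeasurableSet.const _) ?_)
  exact MeasurableSet.iInter fun k => (hA k).compl

theorem measurable_returnedIndex (hr : Measurable (Function.uncurry r)) (hx : Measurable x)
    (hu : Measurable u) (hv : Measurable v) :
    Measurable fun b => returnedIndex P (P.withDensity (r b)) (r b) (x b) (u b) (v b) := by
  have htime : Measurable fun b => stopTime P (P.withDensity (r b)) (r b) (x b) (u b) (v b) :=
    measurable_sInf_nat
      (A := fun d => {b | Accepts P (P.withDensity (r b)) (r b) (x b) (u b) (v b) d})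
      fun d => measurableSet_accepts hr hx hu hv d
  have h : Measurable fun p : β × ℕ =>
      (state P (P.withDensity (r p.1)) (r p.1) (x p.1) (v p.1) p.2).index :=
    measurable_from_prod_countable_left fun d => (measurable_state hr hx hv d).1
  have h' := h.comp (measurable_id.prodMk htime)
  exact h'

theorem measurable_parentCost {n : β → ℕ} (hx : Measurable x) (hn : Measurable n) :
    Measurable fun b => parentCost P (x b) (n b) := by
  refine Measurable.ite (measurableSet_eq_fun hn measurable_const) measurable_const ?_
  have hn2 : Measurable fun b => n b / 2 := (measurable_of_countable fun k : ℕ => k / 2).comp hn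
  exact measurable_logPlus.comp (measurable_measure_cell P hx hn2).inv

end Measurability

/-! ### Conditional entropy of a point of a random countable set -/

/-- The code length that `(ξ, ℓ)` assigns to the value `y`: the least length `ℓ n` with `ξ n = y`. -/
noncomputable def valueLength (ξ ℓ : ℕ → ℝ) (y : ℝ) : ℝ≥0∞ :=
  open scoped Classical in ⨅ n, if ξ n = y then ENNReal.ofReal (ℓ n) else ∞

open scoped Classical in
/-- Gibbs' inequality: the entropy of a law on the values `ξ n` is bounded by the expected code
length plus the total code weight `∑ exp (-ℓ n)`. -/
theorem entropyBits_le {ν : Measure ℝ} [IsProbabilityMeasure ν] {ξ ℓ : ℕ → ℝ}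
    (hξ : ν (range ξ)ᶜ = 0) :
    entropyBits ν ≤ (∫⁻ y, valueLength ξ ℓ y ∂ν + ∑' n, ENNReal.ofReal (Real.exp (-ℓ n)))
      * (ENNReal.ofReal (Real.log 2))⁻¹ := by
  have hlog : 0 < Real.log 2 := Real.log_pos one_lt_two
  set W : ℝ → ℝ≥0∞ := fun y => ∑' n, if ξ n = y then ENNReal.ofReal (Real.exp (-ℓ n)) else 0
    with hW
  have hterm : ∀ y, ENNReal.ofReal (Real.negMulLog (ν.real {y}))
      ≤ ν {y} * valueLength ξ ℓ y + W y := by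
    intro y
    rcases eq_or_ne (ν {y}) 0 with h0 | h0
    · simp [measureReal_def, h0]
    · rw [valueLength, ENNReal.mul_iInf_of_ne h0 (measure_ne_top _ _), ENNReal.iInf_add]
      refine le_iInf fun n => ?_
      split_ifs with hn
      · have hWn : ENNReal.ofReal (Real.exp (-ℓ n)) ≤ W y := by
          refine le_trans ?_ (ENNReal.le_tsum n)
          rw [if_pos hn]
        calc ENNReal.ofReal (Real.negMulLog (ν.real {y}))
            ≤ ENNReal.ofReal (ν.real {y} * ℓ n + Real.exp (-ℓ n)) :=
              ENNReal.ofReal_le_ofReal (negMulLog_le_mul_add_exp measureReal_nonneg _)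
          _ ≤ ENNReal.ofReal (ν.real {y} * ℓ n) + ENNReal.ofReal (Real.exp (-ℓ n)) :=
              ENNReal.ofReal_add_le
          _ ≤ ν {y} * ENNReal.ofReal (ℓ n) + W y := by
              rw [ENNReal.ofReal_mul measureReal_nonneg, ofReal_measureReal]
              gcongr
      · simp [ENNReal.mul_top h0]
  have hsumW : ∑' y, W y = ∑' n, ENNReal.ofReal (Real.exp (-ℓ n)) := by
    rw [hW, ENNReal.tsum_comm]
    refine tsum_congr fun n => ?_
    exact (tsum_congr fun y => if_congr eq_comm rfl rfl).trans
      (tsum_ite_eq (ξ n) fun _ => ENNReal.ofReal (Real.exp (-ℓ n)))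
  have hsum : ∑' y, ν {y} * valueLength ξ ℓ y ≤ ∫⁻ y, valueLength ξ ℓ y ∂ν := by
    rw [ENNReal.tsum_eq_iSup_sum]
    refine iSup_le fun s => ?_
    refine le_trans (le_of_eq ?_) (setLIntegral_le_lintegral (s : Set ℝ) _)
    rw [lintegral_finset]
    exact Finset.sum_congr rfl fun y _ => mul_comm _ _
  rw [entropyBits, if_pos ⟨range ξ, countable_range ξ, hξ⟩]
  calc ∑' y, ENNReal.ofReal (Real.negMulLog (ν.real {y}) / Real.log 2)
      ≤ ∑' y, (ν {y} * valueLength ξ ℓ y + W y) * (ENNReal.ofReal (Real.log 2))⁻¹ := by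
        refine ENNReal.tsum_le_tsum fun y => ?_
        rw [ENNReal.ofReal_div_of_pos hlog, div_eq_mul_inv]
        exact mul_le_mul_left (hterm y) _
    _ = (∑' y, ν {y} * valueLength ξ ℓ y + ∑' y, W y) * (ENNReal.ofReal (Real.log 2))⁻¹ := by
        rw [ENNReal.tsum_mul_right, ENNReal.tsum_add]
    _ ≤ _ := by
        rw [hsumW]
        gcongr

/-- If `S` is almost surely a point `ξ Z N` of a countable set that depends only on `Z`, then
its conditional entropy given `Z` is bounded by the expected code length of the index `N` plus
the expected total code weight, for any code lengths `ℓ Z` that depend only on `Z`. -/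
theorem condEntropyBits_le {Ω E : Type*} [MeasurableSpace Ω] [MeasurableSpace E] {μ : Measure Ω}
    [IsProbabilityMeasure μ] {S : Ω → ℝ} {Z : Ω → E} (hS : Measurable S) (hZ : Measurable Z)
    {ξ ℓ : E → ℕ → ℝ} (hξ : Measurable ξ) (hℓ : Measurable ℓ) {N : Ω → ℕ}
    (hN : ∀ᵐ ω ∂μ, ξ (Z ω) (N ω) = S ω) :
    condEntropyBits S Z μ ≤ (∫⁻ ω, ENNReal.ofReal (ℓ (Z ω) (N ω)) ∂μ
        + ∫⁻ ω, ∑' n, ENNReal.ofReal (Real.exp (-ℓ (Z ω) n)) ∂μ)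
      * (ENNReal.ofReal (Real.log 2))⁻¹ := by
  classical
  have hξn : ∀ n, Measurable fun z => ξ z n := fun n => measurable_pi_iff.1 hξ n
  have hℓn : ∀ n, Measurable fun z => ℓ z n := fun n => measurable_pi_iff.1 hℓ n
  have heq : ∀ n, MeasurableSet {p : E × ℝ | ξ p.1 n = p.2} := fun n =>
    measurableSet_eq_fun ((hξn n).comp measurable_fst) measurable_snd
  have hval : Measurable fun p : E × ℝ => valueLength (ξ p.1) (ℓ p.1) p.2 := by
    refine Measurable.iInf fun n => Measurable.ite (heq n) ?_ measurable_const
    exact ENNReal.measurable_ofReal.comp ((hℓn n).comp measurable_fst)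
  have hwt : Measurable fun z => ∑' n, ENNReal.ofReal (Real.exp (-ℓ z n)) :=
    Measurable.tsum fun n =>
      ENNReal.measurable_ofReal.comp (Real.measurable_exp.comp (hℓn n).neg)
  have hint : Measurable fun z => ∫⁻ y, valueLength (ξ z) (ℓ z) y ∂(condDistrib S Z μ z) :=
    hval.lintegral_kernel_prod_right'
  have hcond := compProd_map_condDistrib (mβ := ‹MeasurableSpace E›) (X := Z) (μ := μ)
    hS.aemeasurable
  have hrange : MeasurableSet {p : E × ℝ | p.2 ∈ range (ξ p.1)} := by
    have : {p : E × ℝ | p.2 ∈ range (ξ p.1)} = ⋃ n, {p : E × ℝ | ξ p.1 n = p.2} := by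
      ext p; simp
    rw [this]
    exact MeasurableSet.iUnion heq
  have hsupp : ∀ᵐ z ∂(μ.map Z), condDistrib S Z μ z (range (ξ z))ᶜ = 0 := by
    have h1 : ∀ᵐ p ∂(μ.map Z ⊗ₘ condDistrib S Z μ), p.2 ∈ range (ξ p.1) := by
      rw [hcond, ae_map_iff (hZ.prodMk hS).aemeasurable hrange]
      filter_upwards [hN] with ω hω using ⟨N ω, hω⟩
    filter_upwards [Measure.ae_ae_of_ae_compProd h1] with z hz
    exact hz
  rw [condEntropyBits]
  calc ∫⁻ z, entropyBits (condDistrib S Z μ z) ∂(μ.map Z)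
      ≤ ∫⁻ z, (∫⁻ y, valueLength (ξ z) (ℓ z) y ∂(condDistrib S Z μ z)
          + ∑' n, ENNReal.ofReal (Real.exp (-ℓ z n))) * (ENNReal.ofReal (Real.log 2))⁻¹
          ∂(μ.map Z) := by
        refine lintegral_mono_ae ?_
        filter_upwards [hsupp] with z hz using entropyBits_le hz
    _ = (∫⁻ ω, valueLength (ξ (Z ω)) (ℓ (Z ω)) (S ω) ∂μ
          + ∫⁻ ω, ∑' n, ENNReal.ofReal (Real.exp (-ℓ (Z ω) n)) ∂μ)
          * (ENNReal.ofReal (Real.log 2))⁻¹ := by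
        rw [lintegral_mul_const _ (by fun_prop), lintegral_add_right _ hwt, ← Measure.lintegral_compProd hval, hcond,
          lintegral_map hval (hZ.prodMk hS), lintegral_map hwt hZ]
    _ ≤ _ := by
        gcongr ?_ * _
        refine add_le_add_left (lintegral_mono_ae ?_) _
        filter_upwards [hN] with ω hω
        refine (iInf_le _ (N ω)).trans ?_
        rw [if_pos hω]

/-! ### Recovering the split points from the partition -/

open scoped Classical in
/-- The split point of the node `n`, computed from the partition as the supremum of the rational
points of the left child of `n`. -/
noncomputable def splitPoint (z : ℕ → Set ℝ) (n : ℕ) : ℝ :=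
  (⨆ q : ℚ, if (q : ℝ) ∈ z (2 * n) then ((q : ℝ) : EReal) else ⊥).toReal

theorem measurable_splitPoint : Measurable splitPoint := by
  refine measurable_pi_iff.2 fun n => measurable_ereal_toReal.comp ?_
  refine Measurable.iSup fun q => Measurable.ite ?_ measurable_const measurable_const
  exact measurableSet_setOfPred.2 ((measurable_set_mem (q : ℝ)).comp (measurable_pi_apply (2 * n)))

theorem ordConnected_cell (x : ℕ → ℝ) (n : ℕ) : (cell x n).OrdConnected := by
  induction n using Nat.strong_induction_on with
  | _ n ih =>
    match n with
    | 0 => rw [cell]; exact ordConnected_univ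
    | 1 => rw [cell]; exact ordConnected_univ
    | n + 2 =>
      rw [cell]
      split_ifs
      · exact (ih _ (by omega)).inter ordConnected_Iic
      · exact (ih _ (by omega)).inter ordConnected_Ioi

theorem splitPoint_cell {P : Measure ℝ} [NullSingletonClass P] {x u v : ℕ → ℝ}
    (hreg : Regular P x u v) {n : ℕ} (hn : 1 ≤ n) : splitPoint (cell x) n = x n := by
  classical
  have hsup : (⨆ q : ℚ, if (q : ℝ) ∈ cell x (2 * n) then ((q : ℝ) : EReal) else ⊥) = (x n : EReal)
      := by
    apply le_antisymm
    · refine iSup_le fun q => ?_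
      split_ifs with hq
      · rw [cell_left x hn] at hq
        exact EReal.coe_le_coe_iff.2 hq.2
      · exact bot_le
    · obtain ⟨y, hy, hyx⟩ : ∃ y ∈ cell x (2 * n), y ≠ x n := by
        by_contra! hc
        refine hreg.measure_cell_ne_zero (2 * n) (by omega) ?_
        exact measure_mono_null (fun y hy => mem_singleton_iff.2 (hc y hy)) (measure_singleton (x n))
      rw [cell_left x hn] at hy
      have hlt : y < x n := lt_of_le_of_ne hy.2 hyx
      refine le_of_forall_lt fun b hb => ?_
      obtain ⟨c, hbc, hcx⟩ := EReal.lt_iff_exists_real_btwn.1 hb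
      have hcx' : c < x n := EReal.coe_lt_coe_iff.1 hcx
      obtain ⟨q, hq1, hq2⟩ := exists_rat_btwn (max_lt hcx' hlt)
      have hmem : (q : ℝ) ∈ cell x (2 * n) := by
        rw [cell_left x hn]
        exact ⟨(ordConnected_cell x n).out hy.1 (hreg.mem_cell n hn)
          ⟨((le_max_right _ _).trans_lt hq1).le, hq2.le⟩, hq2.le⟩
      refine (hbc.trans (EReal.coe_lt_coe_iff.2 ((le_max_left _ _).trans_lt hq1))).trans_le ?_
      refine le_trans (le_of_eq ?_) (le_iSup _ q)
      rw [if_pos hmem]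
  rw [splitPoint, hsup, EReal.toReal_coe]

theorem cell_congr_pos {x x' : ℕ → ℝ} (h : ∀ m, 1 ≤ m → x m = x' m) (n : ℕ) :
    cell x n = cell x' n := by
  induction n using Nat.strong_induction_on with
  | _ n ih =>
    match n with
    | 0 => simp [cell]
    | 1 => simp [cell]
    | n + 2 => rw [cell, cell, ih _ (by omega), h _ (by omega)]

/-! ### The code for the nodes -/

/-- The length, in nats, of the code word for the node `n`: the code allots weight
`weight (P (Z_m)) / 2` to each child of the node `m`, and weight `1` to the root. -/
noncomputable def codeLength (P : Measure ℝ) (x : ℕ → ℝ) (n : ℕ) : ℝ :=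
  if n = 1 then 0 else Real.log 2 - Real.log (P.real (cell x (n / 2)))
    + 2 * Real.log (1 - Real.log (P.real (cell x (n / 2))))

theorem measurable_codeLength (P : Measure ℝ) [SFinite P] (n : ℕ) :
    Measurable fun x => codeLength P x n := by
  have h : Measurable fun x => P.real (cell x (n / 2)) :=
    (measurable_measure_cell P measurable_id measurable_const).ennreal_toReal
  unfold codeLength
  split_ifs <;> fun_prop

theorem exp_neg_codeLength {P : Measure ℝ} [IsProbabilityMeasure P] {x : ℕ → ℝ} {n : ℕ}
    (hn : n ≠ 1) (hP : P (cell x (n / 2)) ≠ 0) :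
    Real.exp (-codeLength P x n) = weight (P.real (cell x (n / 2))) / 2 := by
  have hp : 0 < P.real (cell x (n / 2)) := ENNReal.toReal_pos hP (measure_ne_top _ _)
  have hl := one_le_one_sub_log hp.le (measureReal_le_one (μ := P))
  have hl0 : 0 < 1 - Real.log (P.real (cell x (n / 2))) := by linarith
  rw [codeLength, if_neg hn, weight, show ∀ a b c : ℝ, -(a - b + 2 * c) = b - a - (c + c) by
    intros; ring, Real.exp_sub, Real.exp_sub, Real.exp_add, Real.exp_log hp, Real.exp_log two_pos,
    Real.exp_log hl0]
  field_simp

theorem tsum_exp_neg_codeLength {P : Measure ℝ} [IsProbabilityMeasure P] {x : ℕ → ℝ}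
    (hP : ∀ n, 1 ≤ n → P (cell x n) ≠ 0) :
    ∑' n, ENNReal.ofReal (Real.exp (-codeLength P x (n + 1)))
      = 1 + ∑' n, ENNReal.ofReal (weight (P.real (cell x (n + 1)))) := by
  have hpair : ∀ n, ENNReal.ofReal (weight (P.real (cell x (n + 1))))
      = ENNReal.ofReal (Real.exp (-codeLength P x (2 * n + 2)))
        + ENNReal.ofReal (Real.exp (-codeLength P x (2 * n + 1 + 2))) := by
    intro n
    have e1 : (2 * n + 2) / 2 = n + 1 := by omega
    have e2 : (2 * n + 1 + 2) / 2 = n + 1 := by omega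
    rw [exp_neg_codeLength (by omega) (by rw [e1]; exact hP _ (by omega)),
      exp_neg_codeLength (by omega) (by rw [e2]; exact hP _ (by omega)), e1, e2,
      ← ENNReal.ofReal_add, add_halves]
    all_goals unfold weight; positivity
  rw [tsum_eq_zero_add' ENNReal.summable, ← tsum_even_add_odd ENNReal.summable ENNReal.summable,
    tsum_congr hpair, ENNReal.tsum_add]
  have hroot : codeLength P x (0 + 1) = 0 := if_pos rfl
  rw [hroot, neg_zero, Real.exp_zero, ENNReal.ofReal_one]

theorem ofReal_codeLength_le {P : Measure ℝ} [IsProbabilityMeasure P] {x : ℕ → ℝ} {n : ℕ}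
    (hP : P (cell x (n / 2)) ≠ 0) {M : ℝ} (hM : 0 ≤ M) :
    ENNReal.ofReal (codeLength P x n)
      ≤ ENNReal.ofReal (Real.log 2 + 2 * Real.log (1 + M))
        + parentCost P x n * ENNReal.ofReal (1 + 2 / (1 + M)) := by
  rw [codeLength, parentCost]
  split_ifs with h1
  · simp
  have hp : 0 < P.real (cell x (n / 2)) := ENNReal.toReal_pos hP (measure_ne_top _ _)
  have hl := one_le_one_sub_log hp.le (measureReal_le_one (μ := P))
  have hlog2 : 0 ≤ Real.log 2 := Real.log_nonneg one_le_two
  have hlogM : 0 ≤ Real.log (1 + M) := Real.log_nonneg (by linarith)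
  rw [logPlus_inv hP, ← measureReal_def, ← ENNReal.ofReal_mul (by linarith),
    ← ENNReal.ofReal_add (by positivity) (mul_nonneg (by linarith) (by positivity))]
  apply ENNReal.ofReal_le_ofReal
  set s := -Real.log (P.real (cell x (n / 2)))
  have hs : Real.log (P.real (cell x (n / 2))) = -s := by simp [s]
  rw [hs] at hl ⊢
  -- the logarithm lies below its tangent at `1 + M`
  have key : Real.log ((1 + s) / (1 + M)) ≤ (1 + s) / (1 + M) - 1 :=
    Real.log_le_sub_one_of_pos (div_pos (by linarith) (by linarith))
  rw [Real.log_div (by linarith) (by linarith)] at key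
  have key2 : (1 + s) / (1 + M) - 1 ≤ s / (1 + M) := by
    rw [add_div]
    have : 1 / (1 + M) ≤ 1 := (div_le_one (by linarith)).2 (by linarith)
    linarith
  have key3 : s * (1 + 2 / (1 + M)) = s + 2 * (s / (1 + M)) := by ring
  rw [key3, show 1 - -s = 1 + s by ring]
  linarith

/-! ### Bounds on the conditional entropy of the returned sample -/

section Main

variable {Ω 𝒴 : Type*} [MeasurableSpace Ω] [MeasurableSpace 𝒴] {μ : Measure Ω}
  [IsProbabilityMeasure μ] {P : Measure ℝ} [IsProbabilityMeasure P] [NullSingletonClass P]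
  {r : 𝒴 → ℝ → ℝ≥0∞} {X U V : ℕ → Ω → ℝ} {Y : Ω → 𝒴}

/-- An expectation for a random target that is independent of the other randomness is the average
of the expectations for the fixed targets. -/
theorem lintegral_indep {W : Type*} [MeasurableSpace W] {R : Ω → W} (hY : Measurable Y)
    (hR : Measurable R) (hind : IndepFun Y R μ) {φ : 𝒴 → W → ℝ≥0∞}
    (hφ : Measurable fun p : 𝒴 × W => φ p.1 p.2) :
    ∫⁻ ω, φ (Y ω) (R ω) ∂μ = ∫⁻ y, ∫⁻ ω, φ y (R ω) ∂μ ∂(μ.map Y) := by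
  have hm := (indepFun_iff_map_prod_eq_prod_map_map hY.aemeasurable hR.aemeasurable).1 hind
  have : IsProbabilityMeasure (μ.map R) := Measure.isProbabilityMeasure_map hR.aemeasurable
  have h := lintegral_map (μ := μ) hφ (hY.prodMk hR)
  rw [hm, lintegral_prod _ hφ.aemeasurable] at h
  rw [← h]
  exact lintegral_congr fun y => lintegral_map (hφ.comp measurable_prodMk_left) hR

/-- The sampler with a random target that is independent of its sources of randomness. -/
theorem IsSampleSplittingSource.random_target (h : IsSampleSplittingSource μ P X U V)
    (hr : Measurable (Function.uncurry r)) (hr1 : ∀ y, ∫⁻ a, r y a ∂P = 1)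
    (hu : ∀ y, IsUnimodal (r y)) (hY : Measurable Y)
    (hind : IndepFun Y (fun ω => ((fun n => X n ω), (fun n => U n ω), (fun n => V n ω))) μ) :
    (Measurable fun ω => returnedSample P (P.withDensity (r (Y ω))) (r (Y ω))
        (fun n => X n ω) (fun n => U n ω) (fun n => V n ω)) ∧
      (∀ᵐ ω ∂μ, Terminates P (P.withDensity (r (Y ω))) (r (Y ω))
        (fun n => X n ω) (fun n => U n ω) (fun n => V n ω)) ∧
      (∫⁻ y, InformationTheory.klDiv (P.withDensity (r y)) P ∂(μ.map Y) ≠ ∞ →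
        condEntropyBits (fun ω => returnedSample P (P.withDensity (r (Y ω))) (r (Y ω))
            (fun n => X n ω) (fun n => U n ω) (fun n => V n ω)) (cells X) μ
          ≤ ENNReal.ofReal
            ((∫⁻ y, InformationTheory.klDiv (P.withDensity (r y)) P ∂(μ.map Y)).toReal / Real.log 2
            + 2 * Real.logb 2
              ((∫⁻ y, InformationTheory.klDiv (P.withDensity (r y)) P ∂(μ.map Y)).toReal
                / Real.log 2 + 1)
            + (1 + 2 * Real.logb 2 3 + 8 / Real.log 2))) := by
  have : IsProbabilityMeasure (μ.map Y) := Measure.isProbabilityMeasure_map hY.aemeasurable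
  have hrY : ∀ y, Measurable (r y) := fun y => hr.comp measurable_prodMk_left
  have hXm : Measurable fun ω n => X n ω := measurable_pi_iff.2 h.measurable_X
  have hUm : Measurable fun ω n => U n ω := measurable_pi_iff.2 h.measurable_U
  have hVm : Measurable fun ω n => V n ω := measurable_pi_iff.2 h.measurable_V
  have hRm := hXm.prodMk (hUm.prodMk hVm)
  -- the parameters of the sampler as functions on `𝒴 × ((ℕ → ℝ) × (ℕ → ℝ) × (ℕ → ℝ))`
  have hpr : Measurable (Function.uncurry fun p : 𝒴 × ((ℕ → ℝ) × (ℕ → ℝ) × (ℕ → ℝ)) => r p.1) :=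
    hr.comp ((measurable_fst.comp measurable_fst).prodMk measurable_snd)
  have hpx : Measurable fun p : 𝒴 × ((ℕ → ℝ) × (ℕ → ℝ) × (ℕ → ℝ)) => p.2.1 := by fun_prop
  have hpu : Measurable fun p : 𝒴 × ((ℕ → ℝ) × (ℕ → ℝ) × (ℕ → ℝ)) => p.2.2.1 := by fun_prop
  have hpv : Measurable fun p : 𝒴 × ((ℕ → ℝ) × (ℕ → ℝ) × (ℕ → ℝ)) => p.2.2.2 := by fun_prop
  have hYR := hY.prodMk hRm
  have hidx := measurable_returnedIndex (P := P) hpr hpx hpu hpv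
  have hNm := hidx.comp hYR
  have hSm : Measurable fun ω => returnedSample P (P.withDensity (r (Y ω))) (r (Y ω))
      (fun n => X n ω) (fun n => U n ω) (fun n => V n ω) := measurable_apply_nat hXm hNm
  have hterm : ∀ᵐ ω ∂μ, Terminates P (P.withDensity (r (Y ω))) (r (Y ω))
      (fun n => X n ω) (fun n => U n ω) (fun n => V n ω) := by
    have hset := measurableSet_terminates (P := P) hpr hpx hpu hpv
    have hm := (indepFun_iff_map_prod_eq_prod_map_map hY.aemeasurable hRm.aemeasurable).1 hind
    have hae : ∀ᵐ p ∂((μ.map Y).prod (μ.map fun ω =>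
        ((fun n => X n ω), (fun n => U n ω), (fun n => V n ω)))),
        Terminates P (P.withDensity (r p.1)) (r p.1) p.2.1 p.2.2.1 p.2.2.2 := by
      rw [Measure.ae_prod_iff_ae_ae hset]
      refine .of_forall fun y => ?_
      refine (ae_map_iff hRm.aemeasurable (p := fun q => Terminates P (P.withDensity (r y)) (r y)
        q.1 q.2.1 q.2.2) (measurable_prodMk_left (x := y) hset)).2 ?_
      exact h.ae_terminates (hrY y) rfl (hr1 y) (hu y)
    rw [← hm] at hae
    exact ae_of_ae_map hYR.aemeasurable hae
  refine ⟨hSm, hterm, fun hfin => ?_⟩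
  set D := ∫⁻ y, InformationTheory.klDiv (P.withDensity (r y)) P ∂(μ.map Y) with hD
  set N : Ω → ℕ := fun ω => returnedIndex P (P.withDensity (r (Y ω))) (r (Y ω))
    (fun n => X n ω) (fun n => U n ω) (fun n => V n ω) with hN
  have hcostm : Measurable fun ω => parentCost P (fun n => X n ω) (N ω) :=
    measurable_parentCost hXm hNm
  have hcost : ∫⁻ ω, parentCost P (fun n => X n ω) (N ω) ∂μ ≤ D + 2 := by
    rw [lintegral_indep (φ := fun y p => parentCost P p.1
      (returnedIndex P (P.withDensity (r y)) (r y) p.1 p.2.1 p.2.2)) hY hRm hind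
      (measurable_parentCost hpx hidx)]
    calc _ ≤ ∫⁻ y, (InformationTheory.klDiv (P.withDensity (r y)) P + 2) ∂(μ.map Y) := by
          refine lintegral_mono fun y => ?_
          have : IsProbabilityMeasure (P.withDensity (r y)) :=
            ⟨by rw [withDensity_apply _ MeasurableSet.univ, Measure.restrict_univ, hr1]⟩
          exact h.lintegral_parentCost_le (hrY y) rfl (hr1 y) (hu y)
      _ = D + 2 := by
          rw [lintegral_add_right _ measurable_const, lintegral_const, measure_univ, mul_one]
  have hN1 : ∀ᵐ ω ∂μ, 1 ≤ N ω := by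
    filter_upwards [h.ae_regular, hterm] with ω hreg ht
    exact (returnedIndex_spec (hrY _) rfl (hr1 _) (hu _) hreg ht).1
  -- code lengths as functions of the partition
  have hpath : ∀ᵐ ω ∂μ, ∀ n, 1 ≤ n → splitPoint (cells X ω) n = X n ω := by
    filter_upwards [h.ae_regular] with ω hreg n hn using splitPoint_cell hreg hn
  have hlen : ∀ᵐ ω ∂μ, ∀ n, codeLength P (splitPoint (cells X ω)) n
      = codeLength P (fun k => X k ω) n := by
    filter_upwards [hpath] with ω hω n
    rw [codeLength, codeLength, cell_congr_pos hω]
  have hent := condEntropyBits_le (μ := μ) hSm (measurable_cells h.measurable_X)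
    (ξ := fun z n => splitPoint z (n + 1)) (ℓ := fun z n => codeLength P (splitPoint z) (n + 1))
    (measurable_pi_iff.2 fun n => measurable_pi_iff.1 measurable_splitPoint (n + 1))
    (measurable_pi_iff.2 fun n => (measurable_codeLength P (n + 1)).comp measurable_splitPoint)
    (N := fun ω => N ω - 1) (by
      filter_upwards [hpath, hN1] with ω hω h1
      rw [Nat.sub_add_cancel h1, hω _ h1]
      rfl)
  refine hent.trans ?_
  set M := D.toReal + 2 with hM
  have hD0 : 0 ≤ D.toReal := ENNReal.toReal_nonneg
  have hDM : D + 2 = ENNReal.ofReal M := by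
    rw [hM, ENNReal.ofReal_add hD0 zero_le_two, ENNReal.ofReal_toReal hfin]
    simp
  have hlog2 : 0 < Real.log 2 := Real.log_pos one_lt_two
  have hlogM : 0 ≤ Real.log (1 + M) := Real.log_nonneg (by linarith)
  have hI1 : ∫⁻ ω, ENNReal.ofReal (codeLength P (splitPoint (cells X ω)) (N ω - 1 + 1)) ∂μ
      ≤ ENNReal.ofReal (Real.log 2 + 2 * Real.log (1 + M) + (M + 2)) := by
    calc _ ≤ ∫⁻ ω, (ENNReal.ofReal (Real.log 2 + 2 * Real.log (1 + M))
          + parentCost P (fun n => X n ω) (N ω) * ENNReal.ofReal (1 + 2 / (1 + M))) ∂μ := by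
          refine lintegral_mono_ae ?_
          filter_upwards [hlen, hN1, h.ae_measure_cell_ne_zero] with ω hω h1 hP
          rw [hω, Nat.sub_add_cancel h1]
          rcases eq_or_ne (N ω) 1 with h2 | h2
          · rw [h2, codeLength, if_pos rfl]
            simp
          · exact ofReal_codeLength_le (hP _ (by omega)) (by linarith)
      _ = ENNReal.ofReal (Real.log 2 + 2 * Real.log (1 + M))
          + (∫⁻ ω, parentCost P (fun n => X n ω) (N ω) ∂μ) * ENNReal.ofReal (1 + 2 / (1 + M)) := by
          rw [lintegral_add_left measurable_const,
            lintegral_mul_const _ hcostm]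
          simp
      _ ≤ ENNReal.ofReal (Real.log 2 + 2 * Real.log (1 + M))
          + ENNReal.ofReal M * ENNReal.ofReal (1 + 2 / (1 + M)) := by
          rw [← hDM]
          gcongr
      _ ≤ _ := by
          rw [← ENNReal.ofReal_mul (by linarith),
            ← ENNReal.ofReal_add (by positivity) (by positivity)]
          apply ENNReal.ofReal_le_ofReal
          have : M * (2 / (1 + M)) ≤ 2 := by
            rw [mul_div_assoc', div_le_iff₀ (by linarith)]
            linarith
          linarith
  have hI2 : ∫⁻ ω, ∑' n, ENNReal.ofReal
      (Real.exp (-codeLength P (splitPoint (cells X ω)) (n + 1))) ∂μ ≤ ENNReal.ofReal 4 := by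
    have h1 : ∀ᵐ ω ∂μ, ∑' n, ENNReal.ofReal
        (Real.exp (-codeLength P (splitPoint (cells X ω)) (n + 1)))
        = 1 + ∑' n, ENNReal.ofReal (weight (P.real (cells X ω (n + 1)))) := by
      filter_upwards [hlen, h.ae_measure_cell_ne_zero] with ω hω hP
      simp_rw [hω]
      exact tsum_exp_neg_codeLength hP
    rw [lintegral_congr_ae h1, lintegral_add_left measurable_const]
    refine (add_le_add_right h.lintegral_tsum_weight_le _).trans ?_
    rw [lintegral_const, measure_univ, ENNReal.ofReal_ofNat]
    norm_num
  refine (mul_le_mul_left (add_le_add hI1 hI2) _).trans ?_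
  rw [← ENNReal.ofReal_add (by positivity) (by norm_num), ← ENNReal.ofReal_inv_of_pos hlog2,
    ← ENNReal.ofReal_mul (by positivity)]
  apply ENNReal.ofReal_le_ofReal
  have hK0 : 0 ≤ D.toReal / Real.log 2 := by positivity
  have hDK : D.toReal ≤ D.toReal / Real.log 2 := by
    rw [le_div_iff₀ hlog2]
    have : Real.log 2 ≤ 1 := by linarith [Real.log_two_lt_d9]
    exact mul_le_of_le_one_right hD0 this
  have hlog : Real.log (1 + M) / Real.log 2
      ≤ Real.logb 2 3 + Real.logb 2 (D.toReal / Real.log 2 + 1) := by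
    rw [← Real.logb_mul (by norm_num) (by positivity), Real.logb]
    gcongr
    linarith
  have hexp : (Real.log 2 + 2 * Real.log (1 + M) + (M + 2) + 4) * (Real.log 2)⁻¹
      = 1 + 2 * (Real.log (1 + M) / Real.log 2) + D.toReal / Real.log 2 + 8 / Real.log 2 := by
    rw [hM]
    field_simp
    ring
  rw [hexp]
  linarith

end Main

/-- A version of the Radon-Nikodym derivative is a density. -/
theorem withDensity_of_ae_eq_rnDeriv {P Q : Measure ℝ} [SigmaFinite P] [SigmaFinite Q]
    {r : ℝ → ℝ≥0∞} (hQP : Q ≪ P) (hr : r =ᵐ[P] Q.rnDeriv P) : P.withDensity r = Q := by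
  rw [withDensity_congr_ae hr, Measure.withDensity_rnDeriv_eq _ _ hQP]

theorem lintegral_eq_one_of_withDensity {P Q : Measure ℝ} [IsProbabilityMeasure Q]
    {r : ℝ → ℝ≥0∞} (h : P.withDensity r = Q) : ∫⁻ a, r a ∂P = 1 := by
  rw [← setLIntegral_univ, ← withDensity_apply _ MeasurableSet.univ, h, measure_univ]

end GRC

theorem theorem2 :
    ∃ C : ℝ,
      -- a fixed target `Q` and proposal `P`
      (∀ (Ω : Type*) [MeasurableSpace Ω] (μ : Measure Ω) [IsProbabilityMeasure μ]
        (P Q : Measure ℝ) [IsProbabilityMeasure P] [IsProbabilityMeasure Q] [NullSingletonClass P]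
        (r : ℝ → ℝ≥0∞) (X U V : ℕ → Ω → ℝ),
        Q ≪ P → Measurable r → r =ᵐ[P] Q.rnDeriv P → IsUnimodal r →
        GRC.IsSampleSplittingSource μ P X U V →
        let sample : Ω → ℝ := fun ω =>
          GRC.returnedSample P Q r (fun n => X n ω) (fun n => U n ω) (fun n => V n ω)
        let K : ℝ := (InformationTheory.klDiv Q P).toReal / Real.log 2
        AEMeasurable sample μ ∧
        (∀ᵐ ω ∂μ, GRC.Terminates P Q r (fun n => X n ω) (fun n => U n ω) (fun n => V n ω)) ∧
        (InformationTheory.klDiv Q P ≠ ∞ →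
          condEntropyBits sample (GRC.cells X) μ
            ≤ ENNReal.ofReal (K + 2 * Real.logb 2 (K + 1) + C))) ∧
      -- reverse channel coding: target `κ (Y)`, where `κ` is the law of `X` given `Y ∼ ν`,
      -- and the proposal `P` is the marginal law of `X`
      (∀ (Ω 𝒴 : Type*) [MeasurableSpace Ω] [MeasurableSpace 𝒴] (μ : Measure Ω)
        [IsProbabilityMeasure μ] (ν : Measure 𝒴) [IsProbabilityMeasure ν]
        (κ : Kernel 𝒴 ℝ) [IsMarkovKernel κ] (P : Measure ℝ) [NullSingletonClass P]
        (r : 𝒴 → ℝ → ℝ≥0∞) (Y : Ω → 𝒴) (X U V : ℕ → Ω → ℝ),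
        P = ν.bind κ → (∀ y, κ y ≪ P) → Measurable (Function.uncurry r) →
        (∀ y, r y =ᵐ[P] (κ y).rnDeriv P) → (∀ y, IsUnimodal (r y)) →
        GRC.IsSampleSplittingSource μ P X U V → Measurable Y → μ.map Y = ν →
        IndepFun Y (fun ω => ((fun n => X n ω), (fun n => U n ω), (fun n => V n ω))) μ →
        let sample : Ω → ℝ := fun ω =>
          GRC.returnedSample P (κ (Y ω)) (r (Y ω))
            (fun n => X n ω) (fun n => U n ω) (fun n => V n ω)
        let I : ℝ := (∫⁻ y, InformationTheory.klDiv (κ y) P ∂ν).toReal / Real.log 2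
        AEMeasurable sample μ ∧
        (∀ᵐ ω ∂μ, GRC.Terminates P (κ (Y ω)) (r (Y ω))
          (fun n => X n ω) (fun n => U n ω) (fun n => V n ω)) ∧
        (∫⁻ y, InformationTheory.klDiv (κ y) P ∂ν ≠ ∞ →
          condEntropyBits sample (GRC.cells X) μ
            ≤ ENNReal.ofReal (I + 2 * Real.logb 2 (I + 1) + C))) := by
  refine ⟨1 + 2 * Real.logb 2 3 + 8 / Real.log 2, ?_, ?_⟩
  · intro Ω _ μ _ P Q _ _ _ r X U V hQP hrm hr hu h sample K
    have hQ := GRC.withDensity_of_ae_eq_rnDeriv hQP hr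
    have key := h.random_target (r := fun _ : Unit => r) (Y := fun _ => ())
      (hrm.comp measurable_snd) (fun _ => GRC.lintegral_eq_one_of_withDensity hQ) (fun _ => hu)
      measurable_const (indepFun_const_left _ _)
    have : IsProbabilityMeasure (μ.map fun _ => ()) :=
      Measure.isProbabilityMeasure_map aemeasurable_const
    simp only [hQ, lintegral_const, measure_univ, mul_one] at key
    exact ⟨key.1.aemeasurable, key.2⟩
  · intro Ω 𝒴 _ _ μ _ ν _ κ _ P _ r Y X U V hP hκ hrm hr hu h hY hν hind sample I
    have : IsProbabilityMeasure P := by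
      rw [hP]
      infer_instance
    have hQ : ∀ y, P.withDensity (r y) = κ y := fun y =>
      GRC.withDensity_of_ae_eq_rnDeriv (hκ y) (hr y)
    have key := h.random_target hrm (fun y => GRC.lintegral_eq_one_of_withDensity (hQ y)) hu hY hind
    simp only [hQ, hν] at key
    exact ⟨key.1.aemeasurable, key.2⟩
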